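/- **Setting.** Let $G=(V,E)$ be a finite undirected graph on $n$ nodes with integer edge weights $\omega:E\to\mathbb{N}$, $\omega(e)\ge 1$ (the unweighted case is $\omega\equiv 1$), and let $\omega(u,v)$ denote weighted distance. Every node has a unique ID in $\{0,\dots,n^{c}\}$ for a constant $c$. Let $\emptyset\ne S\subseteq V$ and $k\in\mathbb{N}$; initially a node knows its own ID, the IDs of its neighbors, the weights of its edges, whether it is in $S$, and the numbers $|S|$ and $k$. In the CONGEST model computation proceeds in synchronous rounds, and per round each node may send one short message to each neighbor. For $r\in S$ the directed leveled graph (DLG) $\mathcal{L}_r$ of depth $k$ rooted at $r$ has as level $i\le k$ the set of nodes $v$ with $\omega(r,v)=i$, and an arc from $u$ to $v$ (making $u$ a parent of $v$ and $v$ a child of $u$) for each edge $\{u,v\}\in E$ with $u$ on some level $i$, $v$ on level $i+\omega(\{u,v\})$ and $i+\omega(\{u,v\})\le k$. **Algorithm DLGcomp.** Suppose first $\omega\equiv1$. Each node $u$ keeps a set $L$ of roots it has heard of, for each neighbor $u_i$ a set $L_i$ of roots still to be announced to $u_i$, a queue $L_{delay}$, and for each root $r$ a distance $\omega[r]$ and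 a list of parents with arrival times $\tau$. At the start everything is empty and $\omega[r]=\infty$, except that for $u\in S$ we have $L=L_i=\{u\}$ and $\omega[u]=0$. In each of the rounds $t=0,\dots,|S|+k$, $u$ does the following. 1. For each neighbor $u_i$, $u$ lets $l_i=\min (L_i\setminus L_{delay})$ ($\infty$ if this is empty), sends $(l_i,\omega[l_i]+1)$ to $u_i$ if $l_i<\infty$, and receives $(r_i,\omega_i)$ from $u_i$ ($r_i=\infty$ if nothing arrives). 2. Let $R=\{r_i: r_i<l_i\}\setminus L$ and $s=\min L_{delay}$ (with $\min\emptyset=\infty$). If $s\le\min R$ and $s<\infty$, then $s$ is removed from $L_{delay}$. 3. The neighbors $u_i$ are processed one after the other. If $r_i\ge l_i$, then $l_i$ is removed from $L_i$. If $r_i<l_i$ and $\omega_i\le\omega[r_i]$, then: (a) if $\omega_i\le k$, $u_i$ is recorded as a parent of $u$ for the root $r_i$, with arrival time $t$; (b) if $r_i\in L$, $r_i$ is removed from $L_i$, and otherwise $\omega[r_i]:=\omega_i$, $r_i$ is added to $L$ and to all $L_j$ with $j\neq i$, and it is added to $L_{delay}$ if $\min R<r_i$ or $s<r_i$. If $r_i<l_i$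 and $\omega_i>\omega[r_i]$, nothing happens. For general $\omega$, an edge of weight $w$ acts as a path of $w$ links of length one, whose $w-1$ inner relays run the same program as nodes outside $S$ and are simulated by both ends of the edge; only the messages that the two ends put on the path are exchanged over the edge. **Algorithm DLGagr.** It gets the variables left by DLGcomp and an aggregation algorithm $\mathcal{A}'$: for each node and root an initial value, an update of this value that is executed when a message from a child arrives, and a message to the parents that is computed from the current value. In each round $t=0,\dots,|S|+k$ every node sends, for each root $r$ and each parent $h$ recorded for $r$ with arrival time $\tau=|S|+k-t$, the pair of $r$ and its current message for $r$ to $h$; then it executes the update for every message received. **Theorem.** There is an absolute constant $C$ such that in every such network: 1. DLGcomp stops after at most $C(|S|+k)$ rounds, and then for every $r\in S$ the levels and parents stored at the nodes form exactly the DLG $\mathcal{L}_r$ of depth $k$. Per round and direction at most one message is sent over an edge, and if all weights are at most $W$, it has at most $B(\log n+\log W)$ bits, where $B$ depends only on $c$. 2. For every aggregation algorithm $\mathcal{A}'$, DLGagr, run on the result of DLGcomp, stops after at most $C(|S|+k)$ rounds, and then for every $r\in S$ information has been aggregated bottom-up through $\mathcal{L}_r$: the final value of each node $u$ for $r$ arises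 from its initial value by processing, for each child $c$ of $u$ in $\mathcal{L}_r$ exactly once and in some order, the message that $\mathcal{A}'$ computes from the final value of $c$ for $r$. Per round and direction at most one message is sent over an edge, and if the messages that $\mathcal{A}'$ computes from the final values have at most $b$ bits, it has at most $B\log n+b$ bits. -/

import Mathlib

/-! ### Weighted distances and directed leveled graphs -/

section Graphs

variable {V : Type*}

/-- The weighted distance: the least weight of a walk from `u` to `v`, and `⊤` if there is none. -/
noncomputable def wdist (G : SimpleGraph V) (ω : Sym2 V → ℕ) (u v : V) : ℕ∞ :=
  ⨅ p : G.Walk u v, (((p.edges.map ω).sum : ℕ) : ℕ∞)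

/-- Data of a leveled graph: its levels and its arcs. -/
@[ext]
structure LeveledGraph (V : Type*) where
  /-- `level i` is the set of nodes on level `i`. -/
  level : ℕ → Set V
  /-- `arc u v`: there is an arc directed from `u` to `v` (`u` is a parent of `v`). -/
  arc : V → V → Prop

/-- The directed leveled graph of depth `k` rooted at `r`: level `i ≤ k` consists of the nodes at
weighted distance `i` from `r`, and an edge `{u, v}` is directed from `u` to `v` if `u` is on some
level `i` and `v` is on level `i + ω {u, v}`. -/
def directedLeveledGraph (G : SimpleGraph V) (ω : Sym2 V → ℕ) (k : ℕ) (r : V) :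
    LeveledGraph V where
  level i := {v | i ≤ k ∧ wdist G ω r v = i}
  arc u v := G.Adj u v ∧ ∃ i : ℕ, wdist G ω r u = i ∧ i + ω s(u, v) ≤ k ∧
    wdist G ω r v = ((i + ω s(u, v) : ℕ) : ℕ∞)

end Graphs

/-! ### Synchronous message passing -/

/-- A synchronous distributed algorithm, as the program that every node runs. A node sees only its
local input (of type `I`), the round number, its own state (of type `σ`) and the messages (of type
`μ`) that its neighbors send to it. `send i t s v` lists the messages that are sent to the neighbor
`v` in round `t`; the CONGEST model asks that these are at most one short message. -/
structure SyncAlgorithm (V I σ μ : Type*) where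
  /-- The state before the first round. -/
  start : I → σ
  /-- Local input, round, state and receiving neighbor to the messages sent. -/
  send : I → ℕ → σ → V → List μ
  /-- Local input, round, state and inbox (indexed by the sending neighbor) to the new state. -/
  recv : I → ℕ → σ → (V → List μ) → σ
  /-- The number of rounds after which the node stops. -/
  rounds : I → ℕ

namespace SyncAlgorithm

variable {V I σ μ : Type*} (A : SyncAlgorithm V I σ μ)

/-- The states of all nodes at the beginning of round `t`. -/
def stateAt (G : SimpleGraph V) [DecidableRel G.Adj] (input : V → I) : ℕ → V → σ
  | 0 => fun u => A.start (input u)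
  | t + 1 =>
    let prev := stateAt G input t
    fun u => A.recv (input u) t (prev u)
      (fun v => if G.Adj v u then A.send (input v) t (prev v) u else [])

/-- The state of a node when it stops. -/
def final (G : SimpleGraph V) [DecidableRel G.Adj] (input : V → I) (u : V) : σ :=
  A.stateAt G input (A.rounds (input u)) u

/-- In every round every node sends at most one message over each of its edges, and that message
has at most `b` bits when `bits` measures the length of messages. -/
def RespectsBandwidth (G : SimpleGraph V) [DecidableRel G.Adj] (input : V → I) (bits : μ → ℕ)
    (b : ℕ) : Prop :=
  ∀ u v, G.Adj u v → ∀ t < A.rounds (input u),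
    (A.send (input u) t (A.stateAt G input t u) v).length ≤ 1 ∧
      ∀ m ∈ A.send (input u) t (A.stateAt G input t u) v, bits m ≤ b

end SyncAlgorithm

/-- What a node knows at the beginning: its name, its neighbors, the weights of its edges, whether
it is one of the roots, the number of roots and the depth. Names are compared by the order of `V`,
which is the order of the IDs. -/
structure LocalView (V : Type*) where
  self : V
  nbrs : Finset V
  weight : V → ℕ
  isRoot : Bool
  numRoots : ℕ
  depth : ℕ

/-- The local views in the network `G` with weights `ω`, set of roots `S` and depth `k`. -/
def localView {V : Type*} [Fintype V] [DecidableEq V] (G : SimpleGraph V) [DecidableRel G.Adj]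
    (ω : Sym2 V → ℕ) (S : Finset V) (k : ℕ) (u : V) : LocalView V where
  self := u
  nbrs := G.neighborFinset u
  weight v := if G.Adj u v then ω s(u, v) else 0
  isRoot := decide (u ∈ S)
  numRoots := S.card
  depth := k

/-! ### The node program of DLGcomp

The program is written for nodes whose incident links are labelled by a type `P`, because it is run
by the nodes of the network and also by the relays that simulate edge weights. Names of roots are
of type `V`, and `⊤ : WithTop V` stands for "no message". -/

/-- An `r`-message: the name of the root `r` and the distance from `r` to the receiver. -/
abbrev DLGMessage (V : Type*) := V × ℕ

/-- The variables of the program: the set `L` of roots heard of, the sets `L_i` of roots still to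
be announced over link `i`, the delay queue, the distances `ω[r]`, and for each root the list of
all pairs `(parent_in_T[i], τ[i])` for `i = 1, …, sp`, that is, the parents with the times at which
their messages came in. -/
structure DLGState (V P : Type*) where
  L : Finset V
  Lp : P → Finset V
  delay : Finset V
  dist : V → ℕ∞
  parents : V → List (P × ℕ)

namespace DLGState

variable {V P : Type*} [LinearOrder V] [DecidableEq P]

/-- The initial state of a node that is no root. -/
def idle : DLGState V P := ⟨∅, fun _ => ∅, ∅, fun _ => ⊤, fun _ => []⟩

/-- The initial state of the root `u`. -/
def root (u : V) : DLGState V P :=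
  ⟨{u}, fun _ => {u}, ∅, fun r => if r = u then 0 else ⊤, fun _ => []⟩

/-- The value `l_i`: the smallest root in `L_i` that is not delayed, `⊤` if there is none. -/
def next (s : DLGState V P) (i : P) : WithTop V := (s.Lp i \ s.delay).min

/-- The message that is sent over link `i`: the name `l_i` and the distance of the receiver along a
link of length one. (All distances of roots in `L` are finite.) -/
def outgoing (s : DLGState V P) (i : P) : Option (DLGMessage V) :=
  match s.next i with
  | none => none
  | some l => some (l, (s.dist l).toNat + 1)

/-- The root named in a possible message. -/
def rootOf : Option (DLGMessage V) → WithTop V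
  | none => ⊤
  | some m => (m.1 : WithTop V)

/-- The body of the loop that processes what came in over link `i` in round `t`. Here `l` are the
values `l_i` of this round, `inc` the incoming messages, `minR` is `min R` and `q` is the least
element of the delay queue at the beginning of the round. -/
def process (k t : ℕ) (l : P → WithTop V) (inc : P → Option (DLGMessage V)) (minR q : WithTop V)
    (s : DLGState V P) (i : P) : DLGState V P :=
  if rootOf (inc i) < l i then
    match inc i with
    | none => s
    | some (r, d) =>
      if (d : ℕ∞) ≤ s.dist r then
        let s' : DLGState V P :=
          if d ≤ k then
            { s with parents := Function.update s.parents r (s.parents r ++ [(i, t)]) }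
          else s
        if r ∉ s.L then
          { s' with
            dist := Function.update s.dist r d
            L := insert r s.L
            Lp := fun j => if j = i then s.Lp j else insert r (s.Lp j)
            delay := if minR < r ∨ q < r then insert r s.delay else s.delay }
        else
          { s' with Lp := Function.update s.Lp i ((s.Lp i).erase r) }
      else s
  else
    { s with Lp := Function.update s.Lp i ((s.Lp i).filter (fun v => (v : WithTop V) ≠ l i)) }

/-- One round: `links` lists the links in the order in which they are processed, `inc` is the inbox
of round `t`. -/
def round (k t : ℕ) (links : List P) (inc : P → Option (DLGMessage V)) (s : DLGState V P) :
    DLGState V P :=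
  let l : P → WithTop V := s.next
  let R : Finset V :=
    (links.filterMap (fun i =>
      if rootOf (inc i) < l i then (inc i).map Prod.fst else none)).toFinset \ s.L
  let q : WithTop V := s.delay.min
  let s₁ : DLGState V P :=
    if q ≤ R.min ∧ q < ⊤ then
      { s with delay := s.delay.filter (fun v => (v : WithTop V) ≠ q) }
    else s
  links.foldl (process k t l inc R.min q) s₁

end DLGState

/-! ### DLGcomp on a weighted network

A message is delayed on an edge according to the weight of the edge: an edge of weight `w` acts as
a path of `w` links of length one, with `w - 1` relays in between. The relays run the program of a
node that is no root; both ends of the edge keep a copy of their states, and the only messages that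
are exchanged over the edge are those that the two ends put on the path. For weight one there is no
relay, and an end receives directly what the other end sends. -/

/-- The state of a node in DLGcomp: its own variables, and for each neighbor `v` and each position
`1 ≤ j < w` the state of the `j`-th relay on the edge to `v`. Positions are counted from the end
with the lower ID. The link `false` of a relay leads to the lower end, `true` to the higher end. -/
structure DLGcompState (V : Type*) where
  core : DLGState V V
  relay : V → ℕ → DLGState V Bool

namespace DLGcompState

variable {V : Type*} [LinearOrder V]

/-- What the relay at position `j` on the path of length `w` gets over its two links, when `lo` and
`hi` are the messages put on the path by the lower and the higher end. -/
def relayInbox (rel : ℕ → DLGState V Bool) (w : ℕ) (lo hi : Option (DLGMessage V)) (j : ℕ) :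
    Bool → Option (DLGMessage V)
  | false => if j = 1 then lo else (rel (j - 1)).outgoing true
  | true => if j + 1 = w then hi else (rel (j + 1)).outgoing false

/-- What the node `u` gets from the direction of its neighbor `v`, over a path of length `w`, when
`inc` is the message put on the path by `v`. -/
def coreInbox (u v : V) (w : ℕ) (rel : ℕ → DLGState V Bool) (inc : Option (DLGMessage V)) :
    Option (DLGMessage V) :=
  if w ≤ 1 then inc
  else if u < v then (rel 1).outgoing false
  else (rel (w - 1)).outgoing true

end DLGcompState

/-- The algorithm DLGcomp. -/
def DLGcomp (V : Type*) [LinearOrder V] :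
    SyncAlgorithm V (LocalView V) (DLGcompState V) (DLGMessage V) where
  start i :=
    { core := if i.isRoot then DLGState.root i.self else DLGState.idle
      relay := fun _ _ => DLGState.idle }
  send _ _ s v := (s.core.outgoing v).toList
  recv i t s inbox :=
    { core := s.core.round i.depth t (i.nbrs.sort (· ≤ ·)) (fun v =>
        DLGcompState.coreInbox i.self v (i.weight v) (s.relay v) (inbox v).head?)
      relay := fun v j =>
        let mine := s.core.outgoing v
        let other := (inbox v).head?
        let lo := if i.self < v then mine else other
        let hi := if i.self < v then other else mine
        (s.relay v j).round i.depth t [false, true]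
          (DLGcompState.relayInbox (s.relay v) (i.weight v) lo hi j) }
  rounds i := i.numRoots + i.depth + 1

/-- The leveled graph for the root `r` that is stored in a distributed way in the variables of the
nodes: every node stores its level and its parents. -/
def storedLeveledGraph {V : Type*} (k : ℕ) (st : V → DLGcompState V) (r : V) : LeveledGraph V where
  level i := {v | i ≤ k ∧ (st v).core.dist r = i}
  arc u v := ∃ τ : ℕ, (u, τ) ∈ (st v).core.parents r

/-! ### DLGagr -/

/-- An aggregation algorithm, run by the nodes during DLGagr: for each node and each root a
variable of type `β`, the computation executed when a message of a child comes in, and the message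
(of type `M`) for the parents. It may do different things at different nodes and for different
roots. -/
structure Aggregator (V β M : Type*) where
  /-- Node and root to the initial value. -/
  start : V → V → β
  /-- Node, root, child, message of the child and old value to the new value. -/
  step : V → V → V → M → β → β
  /-- Node, root and value to the message for the parents. -/
  out : V → V → β → M

/-- The local input of DLGagr: the local view and the variables left by DLGcomp. -/
structure DLGagrInput (V : Type*) where
  view : LocalView V
  comp : DLGcompState V

/-- The algorithm DLGagr: the schedule stored by DLGcomp is used in reverse order. The state
consists of the values for all roots. -/
def DLGagr {V β M : Type*} [LinearOrder V] (agg : Aggregator V β M) :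
    SyncAlgorithm V (DLGagrInput V) (V → β) (V × M) where
  start i := agg.start i.view.self
  send i t val v :=
    (i.comp.core.L.sort (· ≤ ·)).flatMap fun r =>
      ((i.comp.core.parents r).filter fun p =>
        decide (p.1 = v ∧ t + p.2 = i.view.numRoots + i.view.depth)).map
          fun _ => (r, agg.out i.view.self r (val r))
  recv i _ val inbox :=
    (i.view.nbrs.sort (· ≤ ·)).foldl (fun val' v =>
      (inbox v).foldl (fun val'' m =>
        Function.update val'' m.1 (agg.step i.view.self m.1 v m.2 (val'' m.1))) val') val
  rounds i := i.view.numRoots + i.view.depth + 1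

/-- The values `val u` are the result of the bottom-up aggregation through the leveled graph `D`
for the root `r`: the value of each node results from its initial value by processing, for each of
its children exactly once and in some order, the message computed from the child's own result. -/
def IsBottomUpAggregate {V β M : Type*} (agg : Aggregator V β M) (D : LeveledGraph V) (r : V)
    (val : V → β) : Prop :=
  ∀ u, ∃ children : List V, children.Nodup ∧ (∀ c, c ∈ children ↔ D.arc u c) ∧
    val u = children.foldl (fun b c => agg.step u r c (agg.out c r (val c)) b) (agg.start u r)

/-! ### Slot schedules -/

section Slots

variable {V : Type*}

/-! The run of DLGcomp has a closed form. For a node with root distances `d`, place the names in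
increasing order on the time axis and let each `r` occupy the `d r`-th slot still free (counting
from zero); this is `slot d r`, the round from which the node may announce `r`. A link between nodes
with distances `d` and `e` is treated as a node with distances `min d e`, and `crossTime d e r`, its
slot for `r`, is the round in which `r` crosses the link. Slots of distinct roots are distinct, so
at most one root crosses a link per round, counting both directions.

Everything rests on `freeSlot_interleave`: if `e ≤ d ≤ e + 1`, the free slots of the two schedules
interleave. Hence `r` crosses from a parent before the slot of the receiver, and to a child not
before the slot of the sender, while in each round of waiting a smaller root takes the slot or the
link. So the greedy choices of the program, always the least candidate, follow the schedule, as do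
the comparison `r_i < l_i` and the delay queue. This gives the invariant `NodeInv`, preserved by
`NodeInv.round`.

An edge of weight `w` becomes a path whose relays have distances `pathDist`; each relay satisfies
the same invariant (`NetworkInv`). Only roots in `S` occupy slots, so a root at distance at most `k`
arrives by round `|S| + k`.

For DLGagr, arrival times increase strictly along the arcs of a leveled graph (`arrivalTime_lt`). In
the reversed schedule all children of a node have therefore reported before it sends, and
injectivity of the arrival times keeps the messages on an edge apart. -/

/-- The `n`-th time slot that is left free when the elements of the list are placed one after the
other, starting at the end of the list, and each `r` occupies the `d r`-th slot free by then. -/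
def freeSlot (d : V → ℕ∞) : List V → ℕ → ℕ
  | [], n => n
  | r :: l, n => if (n : ℕ∞) < d r then freeSlot d l n else freeSlot d l (n + 1)

theorem freeSlot_strictMono (d : V → ℕ∞) (l : List V) : StrictMono (freeSlot d l) := by
  induction l with
  | nil => exact fun a b h => h
  | cons r l ih =>
    intro a b h
    simp only [freeSlot]
    split_ifs with h1 h2 h2
    · exact ih h
    · exact ih (by omega)
    · exact absurd (lt_trans (by exact_mod_cast h) h2) h1
    · exact ih (by omega)

/-- At each placement the free index stays or grows by one, and the thresholds `e r ≤ d r ≤ e r + 1`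
keep the order: if index `n` is shifted for `d`, it is shifted for `e`, and if `n` is shifted for
`e`, then `n + 1` is shifted for `d`. -/
theorem freeSlot_interleave {d e : V → ℕ∞} (h : ∀ r, e r ≤ d r ∧ d r ≤ e r + 1) (l : List V)
    (n : ℕ) : freeSlot d l n ≤ freeSlot e l n ∧ freeSlot e l n < freeSlot d l (n + 1) := by
  induction l generalizing n with
  | nil => simp [freeSlot]
  | cons r l ih =>
    obtain ⟨h1, h2⟩ := h r
    simp only [freeSlot]
    constructor
    · split_ifs with ha hb hb
      · exact (ih n).1
      · exact (ih n).1.trans (freeSlot_strictMono e l (Nat.lt_succ_self n)).le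
      · exact absurd (hb.trans_le h1) ha
      · exact (ih (n + 1)).1
    · split_ifs with ha hb hb
      · exact (ih n).2
      · exact (ih n).2.trans (freeSlot_strictMono d l (Nat.lt_succ_self _))
      · refine absurd ?_ ha
        have h3 := hb.trans_le h2
        push_cast at h3
        exact lt_of_add_lt_add_right h3
      · exact (ih (n + 1)).2

/-- Each placed name shifts the index by at most one, and a name at distance `⊤` never does. -/
theorem freeSlot_le (d : V → ℕ∞) (l : List V) (n : ℕ) :
    freeSlot d l n ≤ n + (l.filter (fun r => d r ≠ ⊤)).length := by
  induction l generalizing n with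
  | nil => simp [freeSlot]
  | cons r l ih =>
    simp only [freeSlot]
    by_cases hr : d r = ⊤
    · simpa [hr] using ih n
    · have h1 := ih n
      have h2 := ih (n + 1)
      simp only [List.filter_cons, hr, ne_eq, not_false_eq_true, decide_true, if_true,
        List.length_cons] at h1 h2 ⊢
      split_ifs <;> omega

theorem freeSlot_zero {d : V → ℕ∞} {l : List V} (h : ∀ r ∈ l, d r ≠ 0) : freeSlot d l 0 = 0 := by
  induction l with
  | nil => rfl
  | cons r l ih =>
    have h1 : (0 : ℕ∞) < d r := pos_iff_ne_zero.mpr (h r (by simp))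
    simp only [freeSlot, Nat.cast_zero, h1, if_true]
    exact ih fun r' hr' => h r' (by simp [hr'])

variable [LinearOrder V]

theorem filter_lt_of_pairwise {a : V} {l : List V} (h : (a :: l).Pairwise (· > ·)) :
    (a :: l).filter (· < a) = l ∧
      ∀ r ∈ l, (a :: l).filter (· < r) = l.filter (· < r) := by
  rw [List.pairwise_cons] at h
  refine ⟨?_, fun r hr => ?_⟩
  · simpa using h.1
  · simp [(h.1 r hr).le]

theorem exists_freeSlot_eq_or_occupied (d : V → ℕ∞) {l : List V} (hl : l.Pairwise (· > ·)) (n : ℕ) :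
    (∃ m, freeSlot d l m = n) ∨
      ∃ r ∈ l, d r ≠ ⊤ ∧ freeSlot d (l.filter (· < r)) (d r).toNat = n := by
  induction l with
  | nil => exact Or.inl ⟨n, rfl⟩
  | cons a l ih =>
    obtain ⟨f1, f2⟩ := filter_lt_of_pairwise hl
    rcases ih hl.of_cons with ⟨m, hm⟩ | ⟨r, hr, h1, h2⟩
    -- Placing `a` uses up exactly the free slot of index `d a`: smaller indices keep their number,
    -- larger ones lose one.
    · rcases lt_trichotomy (m : ℕ∞) (d a) with h | h | h
      · exact Or.inl ⟨m, by simp [freeSlot, h, hm]⟩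
      · refine Or.inr ⟨a, by simp, by simp [← h], ?_⟩
        rw [f1, ← h]
        simpa using hm
      · refine Or.inl ⟨m - 1, ?_⟩
        have hm0 : m ≠ 0 := by
          rintro rfl
          simp at h
        obtain ⟨m', rfl⟩ := Nat.exists_eq_succ_of_ne_zero hm0
        have h' : ¬ (m' : ℕ∞) < d a := by
          rw [not_lt]
          exact Order.le_of_lt_add_one (by exact_mod_cast h)
        simp only [Nat.succ_eq_add_one, Nat.add_sub_cancel, freeSlot, h', if_false]
        exact hm
    · exact Or.inr ⟨r, by simp [hr], h1, by rw [f2 r hr]; exact h2⟩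

theorem freeSlot_ne_occupied (d : V → ℕ∞) {l : List V} (hl : l.Pairwise (· > ·)) {r : V}
    (hr : r ∈ l) (hd : d r ≠ ⊤) (n : ℕ) :
    freeSlot d l n ≠ freeSlot d (l.filter (· < r)) (d r).toNat := by
  induction l generalizing n with
  | nil => simp at hr
  | cons a l ih =>
    obtain ⟨f1, f2⟩ := filter_lt_of_pairwise hl
    -- Every slot free after placing `a` was free before, with an index other than `d a`.
    have hf : ∃ m : ℕ, (m : ℕ∞) ≠ d a ∧ freeSlot d (a :: l) n = freeSlot d l m := by
      simp only [freeSlot]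
      split_ifs with h
      · exact ⟨n, h.ne, rfl⟩
      · refine ⟨n + 1, ?_, rfl⟩
        rw [not_lt] at h
        exact (lt_of_le_of_lt h (by exact_mod_cast Nat.lt_succ_self n)).ne'
    obtain ⟨m, hm, hf⟩ := hf
    rw [hf]
    rcases List.mem_cons.mp hr with rfl | hr
    · rw [f1]
      intro h
      have := (freeSlot_strictMono d l).injective h
      rw [this, ENat.natCast_toNat hd] at hm
      exact hm rfl
    · rw [f2 r hr]
      exact ih hl.of_cons hr m

variable [Fintype V]

/-- All smaller names, in decreasing order. -/
def namesBelow (r : V) : List V := ((Finset.univ : Finset V).sort (· ≥ ·)).filter (· < r)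

theorem mem_namesBelow {r s : V} : s ∈ namesBelow r ↔ s < r := by simp [namesBelow]

theorem namesBelow_pairwise (r : V) : (namesBelow r).Pairwise (· > ·) :=
  (Finset.sortedGT_sort _).pairwise.filter _

theorem namesBelow_filter {r s : V} (h : s < r) :
    (namesBelow r).filter (· < s) = namesBelow s := by
  rw [namesBelow, namesBelow, List.filter_filter]
  refine List.filter_congr fun x _ => ?_
  by_cases hx : x < s
  · simp [hx, hx.trans h]
  · simp [hx]

/-- The time slot of `r` when names are placed in increasing order and each `s` occupies the
`d s`-th free slot. -/
def slot (d : V → ℕ∞) (r : V) : ℕ := freeSlot d (namesBelow r) (d r).toNat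

/-- Finiteness matters: `toNat` sends `⊤` to `0`, so `slot` is meaningless for an unreachable root.
-/
theorem slot_injOn {d : V → ℕ∞} {r s : V} (hr : d r ≠ ⊤) (hs : d s ≠ ⊤) (h : slot d r = slot d s) :
    r = s := by
  have key : ∀ r s : V, d r ≠ ⊤ → r < s → slot d s ≠ slot d r := fun r s hr hrs h => by
    have := freeSlot_ne_occupied d (namesBelow_pairwise s) (mem_namesBelow.mpr hrs) hr (d s).toNat
    rw [namesBelow_filter hrs] at this
    exact this h
  rcases lt_trichotomy r s with hrs | hrs | hrs
  · exact absurd h.symm (key r s hr hrs)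
  · exact hrs
  · exact absurd h (key s r hs hrs)

theorem exists_slot_eq_of_forall_ne {d : V → ℕ∞} {r : V} {t : ℕ}
    (h : ∀ m, freeSlot d (namesBelow r) m ≠ t) : ∃ s < r, d s ≠ ⊤ ∧ slot d s = t := by
  rcases exists_freeSlot_eq_or_occupied d (namesBelow_pairwise r) t with ⟨m, hm⟩ | ⟨s, hs, h1, h2⟩
  · exact absurd hm (h m)
  · have hs' := mem_namesBelow.mp hs
    rw [namesBelow_filter hs'] at h2
    exact ⟨s, hs', h1, h2⟩

theorem slot_eq_zero {d : V → ℕ∞} {r : V} (hr : d r = 0) (h : ∀ s, d s = 0 → s = r) :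
    slot d r = 0 := by
  rw [slot, hr]
  exact freeSlot_zero fun s hs h0 => (mem_namesBelow.mp hs).ne (h s h0)

theorem slot_le {d : V → ℕ∞} {S : Finset V} (h : ∀ s, d s ≠ ⊤ → s ∈ S) (r : V) :
    slot d r ≤ (d r).toNat + S.card := by
  refine (freeSlot_le d _ _).trans (Nat.add_le_add_left ?_ _)
  have hn : ((namesBelow r).filter (fun s => d s ≠ ⊤)).Nodup :=
    ((namesBelow_pairwise r).imp fun h => h.ne').filter _
  rw [← List.toFinset_card_of_nodup hn]
  exact Finset.card_le_card fun s hs => h s (by simpa using (List.mem_filter.mp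
    (List.mem_toFinset.mp hs)).2)

theorem slot_le_slot_of_eq {d e : V → ℕ∞} (h : ∀ r, e r ≤ d r ∧ d r ≤ e r + 1) {r : V}
    (hr : e r = d r) : slot d r ≤ slot e r := by
  rw [slot, slot, hr]
  exact (freeSlot_interleave h _ _).1

/-- If `t` were free for `e` with index `m`, then `m < e r` by strict monotonicity, whereas
interleaving gives `d r < m + 1`, contradicting `e r = d r`. -/
theorem exists_slot_eq_of_eq {d e : V → ℕ∞} (h : ∀ r, e r ≤ d r ∧ d r ≤ e r + 1) {r : V}
    (hr : e r = d r) {t : ℕ} (h1 : slot d r ≤ t) (h2 : t < slot e r) :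
    ∃ s < r, e s ≠ ⊤ ∧ slot e s = t := by
  refine exists_slot_eq_of_forall_ne fun m hm => ?_
  subst hm
  rw [slot] at h1 h2
  rw [hr] at h2
  have h3 := (freeSlot_strictMono e _).lt_iff_lt.mp h2
  have h4 := (freeSlot_interleave h (namesBelow r) m).2
  have h5 := (freeSlot_strictMono d (namesBelow r)).lt_iff_lt.mp (lt_of_le_of_lt h1 h4)
  omega

theorem slot_lt_slot_of_add_one_eq {d e : V → ℕ∞} (h : ∀ r, e r ≤ d r ∧ d r ≤ e r + 1) {r : V}
    (hr : e r + 1 = d r) (hd : d r ≠ ⊤) : slot e r < slot d r := by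
  have he : e r ≠ ⊤ := by
    rintro h0
    simp [h0] at hr
    exact hd hr.symm
  rw [slot, slot, ← hr, ENat.toNat_add he (by simp)]
  exact (freeSlot_interleave h _ _).2

/-- If `t` were free for `d` with index `m`, then `m < e r + 1`, whereas interleaving gives `e r <
m`. -/
theorem exists_slot_eq_of_add_one_eq {d e : V → ℕ∞} (h : ∀ r, e r ≤ d r ∧ d r ≤ e r + 1) {r : V}
    (hr : e r + 1 = d r) (hd : d r ≠ ⊤) {t : ℕ}
    (h1 : slot e r < t) (h2 : t < slot d r) : ∃ s < r, d s ≠ ⊤ ∧ slot d s = t := by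
  have he : e r ≠ ⊤ := by
    rintro h0
    simp [h0] at hr
    exact hd hr.symm
  refine exists_slot_eq_of_forall_ne fun m hm => ?_
  subst hm
  rw [slot] at h1 h2
  rw [← hr, ENat.toNat_add he (by simp)] at h2
  have h3 := (freeSlot_strictMono d _).lt_iff_lt.mp h2
  have h4 := (freeSlot_interleave h (namesBelow r) (e r).toNat).1
  have h5 := (freeSlot_strictMono d (namesBelow r)).lt_iff_lt.mp (lt_of_le_of_lt h4 h1)
  simp only [ENat.toNat_one] at h3
  omega

end Slots

/-! ### The schedule of one node -/

section Near

variable {V : Type*}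

/-- The distances of two adjacent nodes. -/
def Near (d e : V → ℕ∞) : Prop := ∀ r, d r ≤ e r + 1 ∧ e r ≤ d r + 1

theorem Near.symm {d e : V → ℕ∞} (h : Near d e) : Near e d := fun r => (h r).symm

/-- This is the interleaving hypothesis for the schedules of a node and of one of its links. -/
theorem Near.link {d e : V → ℕ∞} (h : Near d e) (r : V) :
    min (d r) (e r) ≤ d r ∧ d r ≤ min (d r) (e r) + 1 := by
  refine ⟨min_le_left _ _, ?_⟩
  rcases min_choice (d r) (e r) with h' | h' <;> rw [h']
  · exact le_self_add
  · exact (h r).1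

theorem Near.ne_top {d e : V → ℕ∞} (h : Near d e) {r : V} (hr : d r ≠ ⊤) : e r ≠ ⊤ := by
  intro he
  have := (h r).2
  rw [he, top_le_iff] at this
  exact hr (by simpa using this)

theorem Near.le_or_add_one_eq {d e : V → ℕ∞} (h : Near d e) (r : V) :
    d r ≤ e r ∨ e r + 1 = d r := by
  rcases le_or_gt (d r) (e r) with h' | h'
  · exact Or.inl h'
  · exact Or.inr (le_antisymm (Order.add_one_le_of_lt h') (h r).1)

theorem Near.ne_top_of_min {d e : V → ℕ∞} (h : Near d e) {r : V} (hr : min (d r) (e r) ≠ ⊤) :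
    d r ≠ ⊤ := by
  rcases min_choice (d r) (e r) with h' | h' <;> rw [h'] at hr
  · exact hr
  · exact h.symm.ne_top hr

theorem link_add_one {d e : V → ℕ∞} {r : V} (hr : e r + 1 = d r) :
    min (d r) (e r) + 1 = d r := by
  rw [min_eq_right (by rw [← hr]; exact le_self_add), hr]

end Near

/-! ### Crossing times of a link. -/

section Schedule

variable {V : Type*} [LinearOrder V] [Fintype V]

/-- The round in which `r` crosses the link between two nodes with distances `d` and `e`. -/
noncomputable def crossTime (d e : V → ℕ∞) : V → ℕ := slot fun r => min (d r) (e r)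

theorem crossTime_comm (d e : V → ℕ∞) : crossTime d e = crossTime e d := by
  simp only [crossTime, min_comm]

theorem crossTime_injOn {d e : V → ℕ∞} {r s : V} (hr : d r ≠ ⊤) (hs : d s ≠ ⊤)
    (h : crossTime d e r = crossTime d e s) : r = s :=
  slot_injOn (ne_top_of_le_ne_top hr (min_le_left _ _)) (ne_top_of_le_ne_top hs (min_le_left _ _)) h

theorem Near.slot_le_crossTime {d e : V → ℕ∞} (h : Near d e) {r : V} (hr : d r ≤ e r) :
    slot d r ≤ crossTime d e r :=
  slot_le_slot_of_eq h.link (min_eq_left hr)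

/-- The link is never idle while a released root waits for it: smaller roots are crossing. -/
theorem Near.exists_crossTime_eq {d e : V → ℕ∞} (h : Near d e) {r : V} (hr : d r ≤ e r) {t : ℕ}
    (h1 : slot d r ≤ t) (h2 : t < crossTime d e r) : ∃ s < r, d s ≠ ⊤ ∧ crossTime d e s = t := by
  obtain ⟨s, hs, h3, h4⟩ := exists_slot_eq_of_eq h.link (min_eq_left hr) h1 h2
  exact ⟨s, hs, h.ne_top_of_min h3, h4⟩

theorem Near.crossTime_lt_slot {d e : V → ℕ∞} (h : Near d e) {r : V} (hr : e r + 1 = d r)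
    (hd : d r ≠ ⊤) : crossTime d e r < slot d r :=
  slot_lt_slot_of_add_one_eq h.link (link_add_one hr) hd

/-- A root that has arrived from a parent waits only for slots of smaller roots. -/
theorem Near.exists_slot_eq {d e : V → ℕ∞} (h : Near d e) {r : V} (hr : e r + 1 = d r)
    (hd : d r ≠ ⊤) {t : ℕ} (h1 : crossTime d e r < t) (h2 : t < slot d r) :
    ∃ s < r, d s ≠ ⊤ ∧ slot d s = t :=
  exists_slot_eq_of_add_one_eq h.link (link_add_one hr) hd h1 h2

/-- What a node with distances `d` gets in round `t` over a link from a node with distances `e`. -/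
structure Delivers (d e : V → ℕ∞) (t : ℕ) (m : Option (DLGMessage V)) : Prop where
  eq_some : ∀ r, d r ≠ ⊤ → crossTime d e r = t → e r ≤ d r → m = some (r, (e r).toNat + 1)
  exists_le : ∀ r x, m = some (r, x) → ∃ s ≤ r, d s ≠ ⊤ ∧ crossTime d e s = t

end Schedule

/-! ### The state of one node at the beginning of a round. -/

section Node

variable {V P : Type*}

/-- The distances `dp i` of the neighbors over the links `i` fit to the distances `d` of a node. -/
structure LocalDist (links : List P) (d : V → ℕ∞) (dp : P → V → ℕ∞) : Prop where
  nodup : links.Nodup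
  near : ∀ i ∈ links, Near d (dp i)
  exists_parent : ∀ r, d r ≠ ⊤ → d r ≠ 0 → ∃ i ∈ links, dp i r + 1 = d r
  root_unique : ∀ r s, d r = 0 → d s = 0 → r = s

/-- Over the link `i` the root `r` reaches a node from a parent. -/
def ParentLink (links : List P) (d : V → ℕ∞) (dp : P → V → ℕ∞) (r : V) (i : P) : Prop :=
  i ∈ links ∧ dp i r + 1 = d r ∧ d r ≠ ⊤

variable [LinearOrder V] [Fintype V]

/-- The variables of a node at the beginning of round `t`. -/
structure NodeInv (links : List P) (d : V → ℕ∞) (dp : P → V → ℕ∞) (k t : ℕ)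
    (s : DLGState V P) : Prop where
  mem_L : ∀ r, r ∈ s.L ↔
    d r = 0 ∨ ∃ i, ParentLink links d dp r i ∧ crossTime d (dp i) r < t
  mem_Lp : ∀ i ∈ links, ∀ r, r ∈ s.Lp i ↔ r ∈ s.L ∧ t ≤ crossTime d (dp i) r
  mem_delay : ∀ r, r ∈ s.delay ↔ r ∈ s.L ∧ t < slot d r
  dist_eq : ∀ r, s.dist r = if r ∈ s.L then d r else ⊤
  mem_parents : ∀ r i τ, (i, τ) ∈ s.parents r ↔
    ParentLink links d dp r i ∧ d r ≤ k ∧ τ = crossTime d (dp i) r ∧ τ < t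
  nodup_parents : ∀ r, (s.parents r).Nodup

variable {links : List P} {d : V → ℕ∞} {dp : P → V → ℕ∞} {k t : ℕ} {s : DLGState V P}

theorem LocalDist.slot_root (hw : LocalDist links d dp) {r : V} (hr : d r = 0) : slot d r = 0 :=
  slot_eq_zero hr fun s hs => hw.root_unique s r hs hr

theorem ParentLink.crossTime_lt_slot (hw : LocalDist links d dp) {r : V} {i : P}
    (h : ParentLink links d dp r i) : crossTime d (dp i) r < slot d r :=
  (hw.near i h.1).crossTime_lt_slot h.2.1 h.2.2

theorem NodeInv.ne_top_of_mem (hs : NodeInv links d dp k t s) {r : V} (hr : r ∈ s.L) :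
    d r ≠ ⊤ := by
  rcases (hs.mem_L r).mp hr with h | ⟨i, h, _⟩
  · simp [h]
  · exact h.2.2

theorem NodeInv.mem_L_of_slot_le (hw : LocalDist links d dp) (hs : NodeInv links d dp k t s)
    {r : V} (hr : d r ≠ ⊤) (h : slot d r ≤ t) : r ∈ s.L := by
  rw [hs.mem_L]
  by_cases h0 : d r = 0
  · exact Or.inl h0
  · obtain ⟨i, hi, hp⟩ := hw.exists_parent r hr h0
    have hpl : ParentLink links d dp r i := ⟨hi, hp, hr⟩
    exact Or.inr ⟨i, hpl, (hpl.crossTime_lt_slot hw).trans_le h⟩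

theorem NodeInv.mem_pending (hw : LocalDist links d dp) (hs : NodeInv links d dp k t s) {i : P}
    (hi : i ∈ links) {r : V} :
    r ∈ s.Lp i \ s.delay ↔ d r ≠ ⊤ ∧ slot d r ≤ t ∧ t ≤ crossTime d (dp i) r := by
  rw [Finset.mem_sdiff, hs.mem_Lp i hi, hs.mem_delay]
  constructor
  · rintro ⟨⟨h1, h2⟩, h3⟩
    exact ⟨hs.ne_top_of_mem h1, by by_contra h; exact h3 ⟨h1, by omega⟩, h2⟩
  · rintro ⟨h1, h2, h3⟩
    exact ⟨⟨hs.mem_L_of_slot_le hw h1 h2, h3⟩, fun h => by omega⟩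

/-- A pending root is either due now or waits behind a smaller root that is due now. It cannot be
one that comes from the other end, since then it would have crossed before its slot, hence before
`t`. -/
theorem NodeInv.exists_crossTime_eq (hw : LocalDist links d dp) (hs : NodeInv links d dp k t s)
    {i : P} (hi : i ∈ links) {r : V} (hr : r ∈ s.Lp i \ s.delay) :
    ∃ r' ≤ r, d r' ≠ ⊤ ∧ crossTime d (dp i) r' = t := by
  obtain ⟨h1, h2, h3⟩ := (hs.mem_pending hw hi).mp hr
  rcases h3.eq_or_lt with h3 | h3
  · exact ⟨r, le_rfl, h1, h3.symm⟩
  · rcases (hw.near i hi).le_or_add_one_eq r with h | h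
    · obtain ⟨r', h4, h5⟩ := (hw.near i hi).exists_crossTime_eq h h2 h3
      exact ⟨r', h4.le, h5⟩
    · have := (hw.near i hi).crossTime_lt_slot h h1
      omega

theorem NodeInv.next_eq (hw : LocalDist links d dp) (hs : NodeInv links d dp k t s)
    {i : P} (hi : i ∈ links) {r : V} (hd : d r ≠ ⊤) (hr : d r ≤ dp i r)
    (ht : crossTime d (dp i) r = t) : s.next i = r := by
  have hmem : r ∈ s.Lp i \ s.delay := (hs.mem_pending hw hi).mpr
    ⟨hd, by rw [← ht]; exact (hw.near i hi).slot_le_crossTime hr, ht.ge⟩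
  refine le_antisymm (Finset.min_le hmem) (Finset.le_min fun r' hr' => ?_)
  obtain ⟨r'', h1, h2, h3⟩ := hs.exists_crossTime_eq hw hi hr'
  rw [crossTime_injOn hd h2 (ht.trans h3.symm)]
  exact_mod_cast h1

theorem NodeInv.exists_of_next_eq (hw : LocalDist links d dp) (hs : NodeInv links d dp k t s)
    {i : P} (hi : i ∈ links) {r : V} (h : s.next i = r) :
    ∃ r' ≤ r, d r' ≠ ⊤ ∧ crossTime d (dp i) r' = t :=
  hs.exists_crossTime_eq hw hi (Finset.mem_of_min h)

theorem NodeInv.outgoing_eq (hs : NodeInv links d dp k t s) {i : P} (hi : i ∈ links) :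
    (s.next i = ⊤ ∧ s.outgoing i = none) ∨ ∃ r : V, s.next i = r ∧ d r ≠ ⊤ ∧
      s.outgoing i = some (r, (d r).toNat + 1) := by
  rcases hn : s.next i with _ | r
  · exact Or.inl ⟨rfl, by simp [DLGState.outgoing, hn]⟩
  · have h1 := Finset.mem_of_min hn
    have h2 := ((hs.mem_Lp i hi r).mp (Finset.mem_sdiff.mp h1).1).1
    refine Or.inr ⟨r, rfl, hs.ne_top_of_mem h2, ?_⟩
    simp [DLGState.outgoing, hn, hs.dist_eq, h2]

/-- As `crossTime` is symmetric in the two ends, the invariant of the sender yields what the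
receiver relies on. -/
theorem NodeInv.delivers (hw : LocalDist links d dp) (hs : NodeInv links d dp k t s) {i : P}
    (hi : i ∈ links) : Delivers (dp i) d t (s.outgoing i) where
  eq_some r hr ht hle := by
    rw [crossTime_comm] at ht
    have hn := hs.next_eq hw hi ((hw.near i hi).symm.ne_top hr) hle ht
    rcases hs.outgoing_eq hi with ⟨h, _⟩ | ⟨r', h, _, h'⟩
    · rw [hn] at h
      exact absurd h WithTop.coe_ne_top
    · rw [hn] at h
      rw [h', WithTop.coe_injective h]
  exists_le r x hm := by
    rcases hs.outgoing_eq hi with ⟨_, h⟩ | ⟨r', h, _, h'⟩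
    · rw [h] at hm
      cases hm
    · rw [h'] at hm
      cases hm
      obtain ⟨s', h1, h2, h3⟩ := hs.exists_of_next_eq hw hi h
      exact ⟨s', h1, (hw.near i hi).ne_top h2, by rw [crossTime_comm]; exact h3⟩

/-- The test `r_i < l_i` detects exactly the arrivals from a parent. If the root `r` due on the link
comes from the other end, that end sends `r`, and everything pending here is larger: it is at least
`r`, and `r` itself is not yet released. If `r` is due from this end or from both, then `l_i = r`
and no incoming name is smaller. If no root is due, nothing is sent either way. -/
theorem NodeInv.receive_cases (hw : LocalDist links d dp) (hs : NodeInv links d dp k t s) {i : P}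
    (hi : i ∈ links) {m : Option (DLGMessage V)} (hm : Delivers d (dp i) t m) :
    (∃ r, ParentLink links d dp r i ∧ crossTime d (dp i) r = t ∧ m = some (r, (d r).toNat) ∧
      (r : WithTop V) < s.next i) ∨
    (¬ DLGState.rootOf m < s.next i ∧ ∀ r, d r ≠ ⊤ →
      (crossTime d (dp i) r = t → d r ≤ dp i r) ∧
        ((r : WithTop V) = s.next i ↔ crossTime d (dp i) r = t)) := by
  by_cases hex : ∃ r, d r ≠ ⊤ ∧ crossTime d (dp i) r = t
  · obtain ⟨r, hd, hr⟩ := hex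
    rcases (hw.near i hi).le_or_add_one_eq r with hle | hp
    · have hn := hs.next_eq hw hi hd hle hr
      refine Or.inr ⟨?_, fun r' hd' => ?_⟩
      · rw [not_lt, hn]
        rcases hm' : m with _ | ⟨r', x⟩
        · exact le_top
        · obtain ⟨r'', h1, h2, h3⟩ := hm.exists_le r' x hm'
          rw [crossTime_injOn hd h2 (hr.trans h3.symm)]
          exact WithTop.coe_le_coe.mpr h1
      · rw [hn, WithTop.coe_inj]
        refine ⟨fun h => ?_, fun h => by rw [h, hr],
          fun h => crossTime_injOn hd' hd (h.trans hr.symm)⟩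
        rw [crossTime_injOn hd' hd (h.trans hr.symm)]
        exact hle
    · refine Or.inl ⟨r, ⟨hi, hp, hd⟩, hr, ?_, ?_⟩
      · rw [hm.eq_some r hd hr (by rw [← hp]; exact le_self_add), ← hp,
          ENat.toNat_add ((hw.near i hi).ne_top hd) (by simp), ENat.toNat_one]
      · rcases hs.outgoing_eq hi with ⟨h, _⟩ | ⟨r', h, hd', _⟩
        · rw [h]
          exact WithTop.coe_lt_top r
        · obtain ⟨r'', h1, h2, h3⟩ := hs.exists_of_next_eq hw hi h
          rw [crossTime_injOn h2 hd (h3.trans hr.symm)] at h1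
          rw [h, WithTop.coe_lt_coe]
          refine h1.lt_of_ne ?_
          rintro rfl
          have h4 := ((hs.mem_pending hw hi).mp (Finset.mem_of_min h)).2.1
          have h5 := (hw.near i hi).crossTime_lt_slot hp hd
          omega
  · push Not at hex
    have hn : s.next i = ⊤ := by
      rcases hs.outgoing_eq hi with ⟨h, _⟩ | ⟨r', h, _, _⟩
      · exact h
      · obtain ⟨r'', _, h2, h3⟩ := hs.exists_of_next_eq hw hi h
        exact absurd h3 (hex r'' h2)
    refine Or.inr ⟨?_, fun r hd => ⟨fun h => absurd h (hex r hd), ?_⟩⟩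
    · rcases hm' : m with _ | ⟨r', x⟩
      · simp [DLGState.rootOf]
      · obtain ⟨r'', _, h2, h3⟩ := hm.exists_le r' x hm'
        exact absurd h3 (hex r'' h2)
    · rw [hn]
      exact ⟨fun h => absurd h WithTop.coe_ne_top, fun h => absurd h (hex r hd)⟩

/-- The roots that a node hears of for the first time in a round. -/
theorem NodeInv.mem_fresh (hw : LocalDist links d dp) (hs : NodeInv links d dp k t s)
    {inc : P → Option (DLGMessage V)} (hinc : ∀ i ∈ links, Delivers d (dp i) t (inc i)) {r : V} :
    r ∈ (links.filterMap (fun i =>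
      if DLGState.rootOf (inc i) < s.next i then (inc i).map Prod.fst else none)).toFinset \ s.L ↔
    r ∉ s.L ∧ ∃ i, ParentLink links d dp r i ∧ crossTime d (dp i) r = t := by
  rw [Finset.mem_sdiff, List.mem_toFinset, List.mem_filterMap, and_comm]
  refine and_congr_right fun _ => ⟨?_, ?_⟩
  · rintro ⟨i, hi, h⟩
    rcases hs.receive_cases hw hi (hinc i hi) with ⟨r', h1, h2, h3, h4⟩ | ⟨h1, _⟩
    · rw [h3] at h
      have h5 : DLGState.rootOf (some (r', (d r').toNat)) < s.next i := h4
      rw [if_pos h5] at h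
      obtain rfl : r' = r := by simpa using h
      exact ⟨i, h1, h2⟩
    · rw [if_neg h1] at h
      cases h
  · rintro ⟨i, h1, h2⟩
    refine ⟨i, h1.1, ?_⟩
    rcases hs.receive_cases hw h1.1 (hinc i h1.1) with ⟨r', h1', h2', h3, h4⟩ | ⟨_, h3⟩
    · have h5 : DLGState.rootOf (some (r', (d r').toNat)) < s.next i := h4
      rw [h3, if_pos h5, crossTime_injOn h1.2.2 h1'.2.2 (h2.trans h2'.symm)]
      rfl
    · have h4 := ((h3 r h1.2.2).1 h2)
      rw [← h1.2.1, ENat.add_one_le_iff ((hw.near i h1.1).ne_top h1.2.2)] at h4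
      exact absurd h4 (lt_irrefl _)

end Node

/-! ### One round preserves the invariant of a node. -/

section Round

variable {V P : Type*} [LinearOrder V] [Fintype V]
variable {links : List P} {d : V → ℕ∞} {dp : P → V → ℕ∞} {k t : ℕ} {s : DLGState V P}

theorem NodeInv.mem_delay_iff (hw : LocalDist links d dp) (hs : NodeInv links d dp k t s) {r : V} :
    r ∈ s.delay ↔ (∃ i, ParentLink links d dp r i ∧ crossTime d (dp i) r < t) ∧ t < slot d r := by
  rw [hs.mem_delay, hs.mem_L]
  refine ⟨?_, fun h => ⟨Or.inr h.1, h.2⟩⟩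
  rintro ⟨h | h, h'⟩
  · rw [hw.slot_root h] at h'
    omega
  · exact ⟨h, h'⟩

/-- The roots that wait for their release after a round in which the roots in `R` come in: the
smallest one is released. -/
theorem NodeInv.release (hw : LocalDist links d dp) (hs : NodeInv links d dp k t s) {R : Finset V}
    (hR : ∀ r, r ∈ R ↔ r ∉ s.L ∧ ∃ i, ParentLink links d dp r i ∧ crossTime d (dp i) r = t) {r : V}
    (hr : r ∈ s.delay ∨ r ∈ R) :
    slot d r = t + 1 ↔ (r : WithTop V) ≤ s.delay.min ∧ (r : WithTop V) ≤ R.min := by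
  -- The candidates for release are the roots that arrive by round `t` and have a slot after `t`.
  have hX : ∀ r, (r ∈ s.delay ∨ r ∈ R) ↔
      (∃ i, ParentLink links d dp r i ∧ crossTime d (dp i) r ≤ t) ∧ t < slot d r := by
    intro r
    rw [hs.mem_delay_iff hw, hR]
    constructor
    · rintro (⟨⟨i, h1, h2⟩, h3⟩ | ⟨h0, i, h1, h2⟩)
      · exact ⟨⟨i, h1, h2.le⟩, h3⟩
      · exact ⟨⟨i, h1, h2.le⟩, by rw [← h2]; exact h1.crossTime_lt_slot hw⟩
    · rintro ⟨⟨i, h1, h2⟩, h3⟩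
      by_cases h4 : r ∈ s.L
      · rcases (hs.mem_L r).mp h4 with h5 | h5
        · rw [hw.slot_root h5] at h3
          omega
        · exact Or.inl ⟨h5, h3⟩
      · refine Or.inr ⟨h4, i, h1, h2.antisymm (not_lt.mp fun h5 => h4 ?_)⟩
        exact (hs.mem_L r).mpr (Or.inr ⟨i, h1, h5⟩)
  -- If the slot of a candidate is later than `t + 1`, then `t + 1` is the slot of a smaller root,
  -- which has arrived too. So the least candidate owns slot `t + 1`.
  have key : ∀ r, (r ∈ s.delay ∨ r ∈ R) → ∃ r' ≤ r, (r' ∈ s.delay ∨ r' ∈ R) ∧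
      slot d r' = t + 1 := by
    intro r hr
    obtain ⟨⟨i, h1, h2⟩, h3⟩ := (hX r).mp hr
    rcases (Nat.succ_le_of_lt h3).eq_or_lt with h4 | h4
    · exact ⟨r, le_rfl, hr, h4.symm⟩
    · obtain ⟨r', h5, h6, h7⟩ := (hw.near i h1.1).exists_slot_eq h1.2.1 h1.2.2
        (Nat.lt_succ_of_le h2) h4
      refine ⟨r', h5.le, (hX r').mpr ⟨?_, by omega⟩, h7⟩
      -- The node's own name has slot `0`, so `r'` comes from a parent.
      have h0 : d r' ≠ 0 := fun h0 => by
        rw [hw.slot_root h0] at h7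
        omega
      obtain ⟨j, hj, hp⟩ := hw.exists_parent r' h6 h0
      have hpl : ParentLink links d dp r' j := ⟨hj, hp, h6⟩
      have := hpl.crossTime_lt_slot hw
      exact ⟨j, hpl, by omega⟩
  have hfin : ∀ r, (r ∈ s.delay ∨ r ∈ R) → d r ≠ ⊤ := fun r hr => by
    obtain ⟨⟨i, h1, _⟩, _⟩ := (hX r).mp hr
    exact h1.2.2
  constructor
  · intro h
    have hle : ∀ r', (r' ∈ s.delay ∨ r' ∈ R) → r ≤ r' := fun r' hr' => by
      obtain ⟨r'', h1, h2, h3⟩ := key r' hr'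
      rwa [slot_injOn (hfin r hr) (hfin r'' h2) (h.trans h3.symm)]
    exact ⟨Finset.le_min fun r' h' => WithTop.coe_le_coe.mpr (hle r' (Or.inl h')),
      Finset.le_min fun r' h' => WithTop.coe_le_coe.mpr (hle r' (Or.inr h'))⟩
  · rintro ⟨h1, h2⟩
    obtain ⟨r', h3, h4, h5⟩ := key r hr
    have h6 : r ≤ r' := by
      rcases h4 with h4 | h4
      · exact WithTop.coe_le_coe.mp (h1.trans (Finset.min_le h4))
      · exact WithTop.coe_le_coe.mp (h2.trans (Finset.min_le h4))
    rw [h6.antisymm h3, h5]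

/-- The variables of a node while it processes what came in over its links in round `t`; the links
in `pre` have been processed. -/
structure PartialInv (links : List P) (d : V → ℕ∞) (dp : P → V → ℕ∞) (k t : ℕ)
    (s : DLGState V P) (pre : List P) (s' : DLGState V P) : Prop where
  mem_L : ∀ r, r ∈ s'.L ↔
    r ∈ s.L ∨ ∃ i ∈ pre, ParentLink links d dp r i ∧ crossTime d (dp i) r = t
  mem_Lp : ∀ i ∈ links, ∀ r, r ∈ s'.Lp i ↔
    r ∈ s'.L ∧ t ≤ crossTime d (dp i) r ∧ ¬ (i ∈ pre ∧ crossTime d (dp i) r = t)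
  mem_delay : ∀ r, r ∈ s'.delay ↔ r ∈ s'.L ∧ t + 1 < slot d r
  dist_eq : ∀ r, s'.dist r = if r ∈ s'.L then d r else ⊤
  mem_parents : ∀ r i τ, (i, τ) ∈ s'.parents r ↔ (i, τ) ∈ s.parents r ∨
    i ∈ pre ∧ ParentLink links d dp r i ∧ crossTime d (dp i) r = t ∧ d r ≤ k ∧ τ = t
  nodup_parents : ∀ r, (s'.parents r).Nodup

variable [DecidableEq P]

theorem PartialInv.process (hw : LocalDist links d dp) (hs : NodeInv links d dp k t s)
    {inc : P → Option (DLGMessage V)} (hinc : ∀ i ∈ links, Delivers d (dp i) t (inc i))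
    {R : Finset V}
    (hR : ∀ r, r ∈ R ↔ r ∉ s.L ∧ ∃ i, ParentLink links d dp r i ∧ crossTime d (dp i) r = t)
    {pre : List P} {s' : DLGState V P} (h : PartialInv links d dp k t s pre s') {i : P}
    (hi : i ∈ links) (hpre : i ∉ pre) :
    PartialInv links d dp k t s (pre ++ [i])
      (DLGState.process k t s.next inc R.min s.delay.min s' i) := by
  have htop : ∀ r, r ∈ s'.L → d r ≠ ⊤ := fun r hr => by
    rcases (h.mem_L r).mp hr with h1 | ⟨j, _, h1, _⟩
    · exact hs.ne_top_of_mem h1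
    · exact h1.2.2
  rcases hs.receive_cases hw hi (hinc i hi) with ⟨r, hp, ht, hm, hlt⟩ | ⟨hlt, hcross⟩
  · have hL : ∀ r', (∃ j ∈ pre ++ [i], ParentLink links d dp r' j ∧ crossTime d (dp j) r' = t) ↔
        (∃ j ∈ pre, ParentLink links d dp r' j ∧ crossTime d (dp j) r' = t) ∨ r' = r := by
      intro r'
      constructor
      · rintro ⟨j, hj, h1, h2⟩
        rcases List.mem_append.mp hj with hj | hj
        · exact Or.inl ⟨j, hj, h1, h2⟩
        · obtain rfl : j = i := by simpa using hj
          exact Or.inr (crossTime_injOn h1.2.2 hp.2.2 (h2.trans ht.symm))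
      · rintro (⟨j, hj, h1⟩ | rfl)
        · exact ⟨j, by simp [hj], h1⟩
        · exact ⟨i, by simp, hp, ht⟩
    have hpar : ∀ r' j τ, (j ∈ pre ++ [i] ∧ ParentLink links d dp r' j ∧
        crossTime d (dp j) r' = t ∧ d r' ≤ k ∧ τ = t) ↔
        (j ∈ pre ∧ ParentLink links d dp r' j ∧ crossTime d (dp j) r' = t ∧ d r' ≤ k ∧ τ = t) ∨
          (r' = r ∧ d r ≤ k ∧ (j, τ) = (i, t)) := by
      intro r' j τ
      constructor
      · rintro ⟨hj, h1, h2, h3, h4⟩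
        rcases List.mem_append.mp hj with hj | hj
        · exact Or.inl ⟨hj, h1, h2, h3, h4⟩
        · obtain rfl : j = i := by simpa using hj
          obtain rfl := crossTime_injOn h1.2.2 hp.2.2 (h2.trans ht.symm)
          exact Or.inr ⟨rfl, h3, by rw [h4]⟩
      · rintro (⟨hj, h1⟩ | ⟨rfl, h1, h2⟩)
        · exact ⟨by simp [hj], h1⟩
        · cases h2
          exact ⟨by simp, hp, ht, h1, rfl⟩
    have hcoe : (((d r).toNat : ℕ) : ℕ∞) = d r := ENat.natCast_toNat hp.2.2
    have hdk : (d r).toNat ≤ k ↔ d r ≤ k := by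
      rw [← hcoe]
      simp
    set par' : V → List (P × ℕ) := if (d r).toNat ≤ k then
      Function.update s'.parents r (s'.parents r ++ [(i, t)]) else s'.parents with hpar'
    have hnot : (i, t) ∉ s'.parents r := fun hmem => by
      rcases (h.mem_parents r i t).mp hmem with h1 | h1
      · exact lt_irrefl _ ((hs.mem_parents r i t).mp h1).2.2.2
      · exact hpre h1.1
    have hmp : ∀ r' j τ, (j, τ) ∈ par' r' ↔ (j, τ) ∈ s.parents r' ∨
        j ∈ pre ++ [i] ∧ ParentLink links d dp r' j ∧ crossTime d (dp j) r' = t ∧ d r' ≤ k ∧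
          τ = t := by
      intro r' j τ
      rw [hpar, ← or_assoc, ← h.mem_parents, hpar']
      split_ifs with hk
      · rw [hdk] at hk
        rcases eq_or_ne r' r with rfl | hr
        · simp [hk]
        · simp [hr]
      · rw [hdk] at hk
        simp [hk]
    have hnd : ∀ r', (par' r').Nodup := by
      intro r'
      rw [hpar']
      split_ifs with hk
      · rcases eq_or_ne r' r with rfl | hr
        · rw [Function.update_self]
          exact List.nodup_append.mpr ⟨h.nodup_parents _, by simp, by
            rintro a ha b hb rfl
            obtain rfl : a = (i, t) := by simpa using hb
            exact hnot ha⟩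
        · rw [Function.update_of_ne hr]
          exact h.nodup_parents _
      · exact h.nodup_parents _
    have hroot : DLGState.rootOf (some (r, (d r).toNat)) < s.next i := hlt
    -- The distance test always succeeds here: the stored value is the true distance or still `⊤`.
    have hle : (((d r).toNat : ℕ) : ℕ∞) ≤ s'.dist r := by
      rw [hcoe, h.dist_eq]
      split_ifs
      · exact le_rfl
      · exact le_top
    have hs' : (if (d r).toNat ≤ k then
        { s' with parents := Function.update s'.parents r (s'.parents r ++ [(i, t)]) } else s') =
        { s' with parents := par' } := by
      rw [hpar']
      split_ifs <;> rfl
    simp only [DLGState.process, hm, if_pos hroot, if_pos hle, hs']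
    by_cases hrL : r ∈ s'.L
    · rw [if_neg (not_not.mpr hrL)]
      have hL' : ∀ r', r' ∈ s'.L ↔ r' ∈ s.L ∨
          ∃ j ∈ pre ++ [i], ParentLink links d dp r' j ∧ crossTime d (dp j) r' = t := by
        intro r'
        rw [hL, ← or_assoc, ← h.mem_L]
        exact ⟨Or.inl, fun h1 => h1.elim id fun h2 => h2 ▸ hrL⟩
      refine ⟨hL', fun j hj r' => ?_, h.mem_delay, h.dist_eq, hmp, hnd⟩
      rcases eq_or_ne j i with rfl | hji
      · simp only [Function.update_self, Finset.mem_erase, h.mem_Lp j hj, hpre, false_and,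
          not_false_eq_true, and_true, List.mem_append, List.mem_singleton, or_true, true_and]
        constructor
        · rintro ⟨h1, h2, h3⟩
          exact ⟨h2, h3, fun h4 => h1 (crossTime_injOn (htop _ h2) hp.2.2 (h4.trans ht.symm))⟩
        · rintro ⟨h1, h2, h3⟩
          exact ⟨fun h4 => h3 (h4 ▸ ht), h1, h2⟩
      · simp only [Function.update_of_ne hji, h.mem_Lp j hj, List.mem_append, List.mem_singleton,
          hji, or_false]
    · rw [if_pos hrL]
      have hrs : r ∉ s.L := fun h1 => hrL ((h.mem_L r).mpr (Or.inl h1))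
      have hL' : ∀ r', r' ∈ insert r s'.L ↔ r' ∈ s.L ∨
          ∃ j ∈ pre ++ [i], ParentLink links d dp r' j ∧ crossTime d (dp j) r' = t := by
        intro r'
        rw [hL, ← or_assoc, ← h.mem_L, Finset.mem_insert, or_comm]
      have hslot := hp.crossTime_lt_slot hw
      -- A root heard of for the first time has crossed no other link processed so far: towards
      -- non-parents it crosses only at or after its slot, and an earlier delivery by a parent would
      -- have put it into `L`.
      have hrest : ∀ j ∈ links, t ≤ crossTime d (dp j) r ∧
          ¬ (j ∈ pre ∧ crossTime d (dp j) r = t) := by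
        intro j hj
        rcases (hw.near j hj).le_or_add_one_eq r with h1 | h1
        · have := (hw.near j hj).slot_le_crossTime h1
          exact ⟨by omega, fun h2 => by omega⟩
        · have hpl : ParentLink links d dp r j := ⟨hj, h1, hp.2.2⟩
          refine ⟨not_lt.mp fun h2 => hrs ((hs.mem_L r).mpr (Or.inr ⟨j, hpl, h2⟩)), fun h2 => ?_⟩
          exact hrL ((h.mem_L r).mpr (Or.inr ⟨j, h2.1, hpl, h2.2⟩))
      have hrR : r ∈ R := (hR r).mpr ⟨hrs, i, hp, ht⟩
      have hrel := hs.release hw hR (Or.inr hrR)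
      refine ⟨hL', fun j hj r' => ?_, fun r' => ?_, fun r' => ?_, hmp, hnd⟩
      · rcases eq_or_ne j i with rfl | hji
        · simp only [if_true, h.mem_Lp j hj, hpre, false_and, Finset.mem_insert,
            not_false_eq_true, and_true, List.mem_append, List.mem_singleton, or_true, true_and]
          constructor
          · rintro ⟨h1, h2⟩
            exact ⟨Or.inr h1, h2, fun h4 => hrL ((crossTime_injOn (htop _ h1) hp.2.2
              (h4.trans ht.symm)) ▸ h1)⟩
          · rintro ⟨h1 | h1, h2, h3⟩
            · exact absurd (h1 ▸ ht) h3
            · exact ⟨h1, h2⟩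
        · simp only [if_false, Finset.mem_insert, h.mem_Lp j hj, List.mem_append,
            List.mem_singleton, or_false, hji]
          constructor
          · rintro (rfl | h1)
            · exact ⟨Or.inl rfl, hrest j hj⟩
            · exact ⟨Or.inr h1.1, h1.2⟩
          · rintro ⟨h1 | h1, h2⟩
            · exact Or.inl h1
            · exact Or.inr ⟨h1, h2⟩
      -- The new root is queued exactly if it is not the least candidate, that is, if it does not
      -- own slot `t + 1`.
      · have hcond : (R.min < (r : WithTop V) ∨ s.delay.min < (r : WithTop V)) ↔
            t + 1 < slot d r := by
          rw [← not_iff_not, not_or, not_lt, not_lt, and_comm, ← hrel]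
          omega
        simp only [hcond]
        split_ifs with h1
        · rw [Finset.mem_insert, Finset.mem_insert, h.mem_delay]
          constructor
          · rintro (rfl | h2)
            · exact ⟨Or.inl rfl, h1⟩
            · exact ⟨Or.inr h2.1, h2.2⟩
          · rintro ⟨h2 | h2, h3⟩
            · exact Or.inl h2
            · exact Or.inr ⟨h2, h3⟩
        · rw [Finset.mem_insert, h.mem_delay]
          constructor
          · exact fun h2 => ⟨Or.inr h2.1, h2.2⟩
          · rintro ⟨rfl | h2, h3⟩
            · exact absurd h3 h1
            · exact ⟨h2, h3⟩
      · rcases eq_or_ne r' r with rfl | hr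
        · simp [hcoe]
        · simp [hr, h.dist_eq]
  · have hL : ∀ r', (∃ j ∈ pre ++ [i], ParentLink links d dp r' j ∧ crossTime d (dp j) r' = t) ↔
        ∃ j ∈ pre, ParentLink links d dp r' j ∧ crossTime d (dp j) r' = t := by
      intro r'
      constructor
      · rintro ⟨j, hj, h1, h2⟩
        rcases List.mem_append.mp hj with hj | hj
        · exact ⟨j, hj, h1, h2⟩
        · obtain rfl : j = i := by simpa using hj
          -- Here a root due on the link is no farther from this node than from the peer, so the
          -- peer is no parent.
          have h3 := (hcross r' h1.2.2).1 h2
          rw [← h1.2.1, ENat.add_one_le_iff ((hw.near j h1.1).ne_top h1.2.2)] at h3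
          exact absurd h3 (lt_irrefl _)
      · rintro ⟨j, hj, h1⟩
        exact ⟨j, by simp [hj], h1⟩
    simp only [DLGState.process, if_neg hlt]
    refine ⟨fun r => by rw [hL]; exact h.mem_L r, fun j hj r => ?_, h.mem_delay, h.dist_eq,
      fun r j τ => ?_, h.nodup_parents⟩
    · rcases eq_or_ne j i with rfl | hji
      · simp only [Function.update_self, Finset.mem_filter, h.mem_Lp j hj, hpre, false_and,
          not_false_eq_true, and_true, List.mem_append, List.mem_singleton, or_true, true_and,
          and_assoc]
        refine and_congr_right fun h1 => and_congr_right fun _ => ?_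
        exact not_congr (hcross r (htop r h1)).2
      · simp only [Function.update_of_ne hji, h.mem_Lp j hj, List.mem_append, List.mem_singleton,
          hji, or_false]
    · rw [h.mem_parents]
      refine or_congr_right ⟨fun h1 => ⟨by simp [h1.1], h1.2⟩, fun ⟨h1, h2, h3, h4⟩ => ?_⟩
      obtain ⟨j', hj', h5, h6⟩ := (hL r).mp ⟨j, h1, h2, h3⟩
      refine ⟨?_, h2, h3, h4⟩
      rcases List.mem_append.mp h1 with h7 | h7
      · exact h7
      · obtain rfl : j = i := by simpa using h7
        have h8 := (hcross r h2.2.2).1 h3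
        rw [← h2.2.1, ENat.add_one_le_iff ((hw.near j h2.1).ne_top h2.2.2)] at h8
        exact absurd h8 (lt_irrefl _)

theorem PartialInv.foldl (hw : LocalDist links d dp) (hs : NodeInv links d dp k t s)
    {inc : P → Option (DLGMessage V)} (hinc : ∀ i ∈ links, Delivers d (dp i) t (inc i))
    {R : Finset V}
    (hR : ∀ r, r ∈ R ↔ r ∉ s.L ∧ ∃ i, ParentLink links d dp r i ∧ crossTime d (dp i) r = t)
    (post pre : List P) (hpost : pre ++ post = links) (s' : DLGState V P)
    (h : PartialInv links d dp k t s pre s') :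
    PartialInv links d dp k t s links
      (post.foldl (DLGState.process k t s.next inc R.min s.delay.min) s') := by
  induction post generalizing pre s' with
  | nil =>
    obtain rfl : pre = links := by simpa using hpost
    exact h
  | cons i post ih =>
    have hn := hw.nodup
    rw [← hpost] at hn
    refine ih (pre ++ [i]) (by simpa using hpost) _ (h.process hw hs hinc hR ?_ ?_)
    · simp [← hpost]
    · intro hi
      exact (List.nodup_append.mp hn).2.2 i hi i (by simp) rfl

theorem NodeInv.round (hw : LocalDist links d dp) (hs : NodeInv links d dp k t s)
    {inc : P → Option (DLGMessage V)} (hinc : ∀ i ∈ links, Delivers d (dp i) t (inc i)) :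
    NodeInv links d dp k (t + 1) (s.round k t links inc) := by
  have hR := fun r => hs.mem_fresh hw hinc (r := r)
  unfold DLGState.round
  simp only
  set R : Finset V := (links.filterMap (fun i =>
      if DLGState.rootOf (inc i) < s.next i then (inc i).map Prod.fst else none)).toFinset \ s.L
    with hRdef
  -- The release precedes the loop, so the delay queue already has its form for round `t + 1` when
  -- no link has been processed.
  have h0 : PartialInv links d dp k t s []
      (if s.delay.min ≤ R.min ∧ s.delay.min < ⊤ then
        { s with delay := s.delay.filter (fun v : V => (v : WithTop V) ≠ s.delay.min) } else s) := by
    have hdelay : ∀ r ∈ s.delay, ((s.delay.min ≤ R.min ∧ s.delay.min < ⊤) ∧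
        (r : WithTop V) = s.delay.min) ↔ slot d r = t + 1 := by
      intro r hr
      rw [hs.release hw hR (Or.inl hr)]
      constructor
      · rintro ⟨⟨h1, _⟩, h2⟩
        exact ⟨h2.le, h2 ▸ h1⟩
      · rintro ⟨h1, h2⟩
        have h3 := h1.antisymm (Finset.min_le hr)
        exact ⟨⟨h3 ▸ h2, h3 ▸ WithTop.coe_lt_top r⟩, h3⟩
    have hmem : ∀ r : V, r ∈ (if s.delay.min ≤ R.min ∧ s.delay.min < ⊤ then
        s.delay.filter (fun v : V => (v : WithTop V) ≠ s.delay.min) else s.delay) ↔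
        r ∈ s.L ∧ t + 1 < slot d r := by
      intro r
      have h1 : r ∈ s.L ∧ t + 1 < slot d r ↔ r ∈ s.delay ∧ ¬ slot d r = t + 1 := by
        rw [hs.mem_delay, and_assoc]
        refine and_congr_right fun _ => ?_
        omega
      rw [h1]
      split_ifs with hc
      · rw [Finset.mem_filter]
        exact and_congr_right fun hr => by rw [← hdelay r hr]; simp [hc]
      · exact ⟨fun hr => ⟨hr, fun h2 => hc ((hdelay r hr).mpr h2).1⟩, fun hr => hr.1⟩
    have heq : (if s.delay.min ≤ R.min ∧ s.delay.min < ⊤ then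
        { s with delay := s.delay.filter (fun v : V => (v : WithTop V) ≠ s.delay.min) } else s) =
        { s with delay := if s.delay.min ≤ R.min ∧ s.delay.min < ⊤ then
            s.delay.filter (fun v : V => (v : WithTop V) ≠ s.delay.min) else s.delay } := by
      split_ifs <;> rfl
    rw [heq]
    exact ⟨by simp, fun i hi r => by simpa using hs.mem_Lp i hi r, hmem, hs.dist_eq, by simp,
      hs.nodup_parents⟩
  have h := PartialInv.foldl hw hs hinc hR links [] rfl _ h0
  refine ⟨fun r => ?_, fun i hi r => ?_, h.mem_delay, h.dist_eq, fun r i τ => ?_, h.nodup_parents⟩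
  · rw [h.mem_L, hs.mem_L, or_assoc]
    refine or_congr_right ⟨?_, ?_⟩
    · rintro (⟨i, h1, h2⟩ | ⟨i, _, h1, h2⟩)
      · exact ⟨i, h1, by omega⟩
      · exact ⟨i, h1, by omega⟩
    · rintro ⟨i, h1, h2⟩
      rcases (Nat.lt_succ_iff.mp h2).lt_or_eq with h3 | h3
      · exact Or.inl ⟨i, h1, h3⟩
      · exact Or.inr ⟨i, h1.1, h1, h3⟩
  · rw [h.mem_Lp i hi]
    refine and_congr_right fun _ => ?_
    simp only [hi, true_and]
    omega
  · rw [h.mem_parents, hs.mem_parents]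
    constructor
    · rintro (⟨h1, h2, h3, h4⟩ | ⟨_, h1, h2, h3, h4⟩)
      · exact ⟨h1, h2, h3, by omega⟩
      · exact ⟨h1, h3, h4.trans h2.symm, by omega⟩
    · rintro ⟨h1, h2, h3, h4⟩
      rcases (Nat.lt_succ_iff.mp h4).lt_or_eq with h5 | h5
      · exact Or.inl ⟨h1, h2, h3, h5⟩
      · exact Or.inr ⟨h1.1, h1, h3.symm.trans h5, h2, h5⟩

end Round

/-! ### Weighted distances -/

section WeightedDistance

variable {V : Type*} {G : SimpleGraph V} {ω : Sym2 V → ℕ}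

theorem wdist_le {u v : V} (p : G.Walk u v) : wdist G ω u v ≤ ((p.edges.map ω).sum : ℕ) :=
  iInf_le _ p

theorem exists_walk_of_wdist_ne_top {u v : V} (h : wdist G ω u v ≠ ⊤) :
    ∃ p : G.Walk u v, (((p.edges.map ω).sum : ℕ) : ℕ∞) = wdist G ω u v := by
  have hne : Nonempty (G.Walk u v) := by
    by_contra hemp
    rw [not_nonempty_iff] at hemp
    exact h (by simp [wdist])
  exact ENat.exists_eq_iInf _

theorem wdist_self (u : V) : wdist G ω u u = 0 := by
  simpa using wdist_le (ω := ω) (SimpleGraph.Walk.nil : G.Walk u u)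

theorem wdist_le_add {r u v : V} (h : G.Adj u v) :
    wdist G ω r v ≤ wdist G ω r u + (ω s(u, v) : ℕ) := by
  by_cases ht : wdist G ω r u = ⊤
  · simp [ht]
  · obtain ⟨p, hp⟩ := exists_walk_of_wdist_ne_top ht
    rw [← hp]
    refine (wdist_le (p.concat h)).trans ?_
    simp [SimpleGraph.Walk.edges_concat]

theorem eq_or_exists_adj_wdist_add {r v : V} (h : wdist G ω r v ≠ ⊤) :
    r = v ∨ ∃ u, G.Adj u v ∧ wdist G ω r u + (ω s(u, v) : ℕ) = wdist G ω r v := by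
  obtain ⟨p, hp⟩ := exists_walk_of_wdist_ne_top h
  -- Reversing the optimal walk exposes its last edge to `cases`.
  have hq : (((p.reverse.edges.map ω).sum : ℕ) : ℕ∞) = wdist G ω r v := by
    rw [← hp, SimpleGraph.Walk.edges_reverse, List.map_reverse, List.sum_reverse]
  generalize p.reverse = q at hq
  cases q with
  | nil => exact Or.inl rfl
  | @cons _ u _ hadj q =>
    refine Or.inr ⟨u, hadj.symm, le_antisymm ?_ (wdist_le_add hadj.symm)⟩
    have h1 := wdist_le (ω := ω) q.reverse
    rw [SimpleGraph.Walk.edges_reverse, List.map_reverse, List.sum_reverse] at h1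
    rw [← hq, SimpleGraph.Walk.edges_cons, List.map_cons, List.sum_cons, Sym2.eq_swap, add_comm]
    rw [Nat.cast_add]
    gcongr

theorem eq_of_wdist_eq_zero (hω : ∀ u v, G.Adj u v → 1 ≤ ω s(u, v)) {r v : V}
    (h : wdist G ω r v = 0) : r = v := by
  rcases eq_or_exists_adj_wdist_add (h ▸ ENat.zero_ne_top) with h' | ⟨u, hu, h'⟩
  · exact h'
  · rw [h, add_eq_zero] at h'
    have h2 : ω s(u, v) = 0 := by exact_mod_cast h'.2
    have := hω u v hu
    omega

/-- Any walk can be shortcut to a path, which has at most `n - 1` edges. -/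
theorem toNat_wdist_le [Fintype V] {W : ℕ} (hω : ∀ u v, G.Adj u v → ω s(u, v) ≤ W) {r v : V}
    (h : wdist G ω r v ≠ ⊤) : (wdist G ω r v).toNat ≤ (Fintype.card V - 1) * W := by
  classical
  obtain ⟨p, -⟩ := exists_walk_of_wdist_ne_top h
  have h1 := ENat.toNat_le_of_le_natCast (wdist_le (ω := ω) p.toPath.1)
  have h2 : (p.toPath.1.edges.map ω).sum ≤ p.toPath.1.length * W := by
    have := List.sum_le_card_nsmul (p.toPath.1.edges.map ω) W (by
      intro x hx
      obtain ⟨e, he, rfl⟩ := List.mem_map.mp hx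
      have he' := SimpleGraph.Walk.edges_subset_edgeSet _ he
      induction e using Sym2.ind with
      | _ a b => exact hω a b he')
    simpa using this
  have h3 := p.toPath.2.length_lt
  exact h1.trans (h2.trans (Nat.mul_le_mul_right W (by omega)))

end WeightedDistance

/-! ### Distances on the path that replaces an edge -/

section PathDistance

variable {V : Type*}

/-- The distances at position `j` on a path of length `w` between nodes with distances `d` and
`e`. -/
noncomputable def pathDist (d e : V → ℕ∞) (w j : ℕ) : V → ℕ∞ :=
  fun r => min (d r + j) (e r + (w - j : ℕ))

/-- Two nodes that are joined by an edge of weight `w` have distances `d` and `e`. -/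
def WeightedNear (d e : V → ℕ∞) (w : ℕ) : Prop := ∀ r, d r ≤ e r + w ∧ e r ≤ d r + w

variable {d e : V → ℕ∞} {w : ℕ}

theorem WeightedNear.symm (h : WeightedNear d e w) : WeightedNear e d w := fun r => (h r).symm

theorem pathDist_swap {j : ℕ} (hj : j ≤ w) : pathDist d e w j = pathDist e d w (w - j) := by
  funext r
  rw [pathDist, pathDist, min_comm, Nat.sub_sub_self hj]

theorem WeightedNear.pathDist_zero (h : WeightedNear d e w) : pathDist d e w 0 = d := by
  funext r
  simpa [pathDist] using (h r).1

theorem WeightedNear.pathDist_self (h : WeightedNear d e w) : pathDist d e w w = e := by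
  rw [pathDist_swap le_rfl, Nat.sub_self, h.symm.pathDist_zero]

/-- Adjacent nodes have both distances finite or both infinite, which reduces claims about
`pathDist` to natural number arithmetic. -/
theorem WeightedNear.cases (h : WeightedNear d e w) (r : V) :
    (d r = ⊤ ∧ ∀ j, pathDist d e w j r = ⊤) ∨ ∃ a b : ℕ, d r = a ∧ e r = b ∧ a ≤ b + w ∧
      b ≤ a + w ∧ ∀ j, pathDist d e w j r = (min (a + j) (b + (w - j)) : ℕ) := by
  obtain ⟨h1, h2⟩ := h r
  simp only [pathDist]
  generalize d r = x at *
  generalize e r = y at *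
  cases x with
  | top =>
    cases y with
    | top => exact Or.inl ⟨rfl, by simp⟩
    | coe b => norm_cast at h1
  | coe a =>
    cases y with
    | top => norm_cast at h2
    | coe b =>
      exact Or.inr ⟨a, b, rfl, rfl, by exact_mod_cast h1, by exact_mod_cast h2, fun j =>
        by rw [Nat.mono_cast.map_min]; push_cast; rfl⟩

theorem WeightedNear.near (h : WeightedNear d e w) {j : ℕ} (hj : j < w) :
    Near (pathDist d e w j) (pathDist d e w (j + 1)) := by
  intro r
  rcases h.cases r with ⟨_, h1⟩ | ⟨a, b, _, _, h1, h2, h3⟩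
  · simp [h1]
  · rw [h3, h3]
    norm_cast
    omega

theorem WeightedNear.exists_parent (h : WeightedNear d e w) {j : ℕ} (h0 : 0 < j) (hj : j < w)
    (r : V) : pathDist d e w (j - 1) r + 1 = pathDist d e w j r ∨
      pathDist d e w (j + 1) r + 1 = pathDist d e w j r := by
  rcases h.cases r with ⟨_, h1⟩ | ⟨a, b, _, _, h1, h2, h3⟩
  · simp [h1]
  · rw [h3, h3, h3]
    norm_cast
    omega

theorem WeightedNear.pathDist_ne_zero (h : WeightedNear d e w) {j : ℕ} (h0 : 0 < j) (hj : j < w)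
    (r : V) : pathDist d e w j r ≠ 0 := by
  rcases h.cases r with ⟨_, h1⟩ | ⟨a, b, _, _, h1, h2, h3⟩
  · simp [h1]
  · rw [h3]
    norm_cast
    omega

/-- It translates parents over unit links into parents over weighted edges. -/
theorem WeightedNear.pathDist_one_add_one_eq_iff (h : WeightedNear d e w) (hw : 0 < w) {r : V}
    (hr : d r ≠ ⊤) : pathDist d e w 1 r + 1 = d r ↔ e r + w = d r := by
  rcases h.cases r with ⟨h0, h1⟩ | ⟨a, b, ha, hb, h1, h2, h3⟩
  · exact absurd h0 hr
  · rw [h3, ha, hb]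
    norm_cast
    omega

theorem WeightedNear.pathDist_add_one (h : WeightedNear d e w) {r : V} {j : ℕ} (hj : j < w)
    (hr : d r ≠ ⊤) (he : d r + w = e r) :
    pathDist d e w j r + 1 = pathDist d e w (j + 1) r ∧ pathDist d e w j r ≠ ⊤ := by
  rcases h.cases r with ⟨h0, h1⟩ | ⟨a, b, ha, hb, h1, h2, h3⟩
  · exact absurd h0 hr
  · rw [ha, hb] at he
    rw [h3, h3]
    norm_cast at he ⊢
    refine ⟨by omega, ENat.natCast_ne_top _⟩

end PathDistance

/-! ### Correctness of DLGcomp -/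

section Network

variable {V : Type*}

open Classical in
/-- The distances of a node from the roots. -/
noncomputable def rootDist (G : SimpleGraph V) (ω : Sym2 V → ℕ) (S : Finset V) (u : V) : V → ℕ∞ :=
  fun r => if r ∈ S then wdist G ω r u else ⊤

/-- The distances of the relay, or neighbor, that is next to `u` on the edge to `v`. -/
noncomputable def linkDist (G : SimpleGraph V) (ω : Sym2 V → ℕ) (S : Finset V) (u v : V) :
    V → ℕ∞ :=
  pathDist (rootDist G ω S u) (rootDist G ω S v) (ω s(u, v)) 1

/-- The distances of the two neighbors of a relay. -/
noncomputable def relayPeers (d e : V → ℕ∞) (w j : ℕ) : Bool → V → ℕ∞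
  | false => pathDist d e w (j - 1)
  | true => pathDist d e w (j + 1)

variable {G : SimpleGraph V} {ω : Sym2 V → ℕ} {S : Finset V}

theorem mem_of_rootDist_ne_top {u r : V} (h : rootDist G ω S u r ≠ ⊤) : r ∈ S := by
  by_contra hr
  exact h (by simp [rootDist, hr])

theorem rootDist_of_mem {u r : V} (h : r ∈ S) : rootDist G ω S u r = wdist G ω r u := by
  simp [rootDist, h]

theorem weightedNear_rootDist {u v : V} (h : G.Adj u v) :
    WeightedNear (rootDist G ω S u) (rootDist G ω S v) (ω s(u, v)) := by
  intro r
  by_cases hr : r ∈ S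
  · rw [rootDist_of_mem hr, rootDist_of_mem hr]
    exact ⟨by rw [Sym2.eq_swap]; exact wdist_le_add h.symm, wdist_le_add h⟩
  · simp [rootDist, hr]

theorem localDist_relay {d e : V → ℕ∞} {w j : ℕ} (h : WeightedNear d e w) (h0 : 0 < j)
    (hj : j < w) : LocalDist [false, true] (pathDist d e w j) (relayPeers d e w j) where
  nodup := by simp
  near i _ := by
    cases i
    · have := h.near (j := j - 1) (by omega)
      rw [Nat.sub_add_cancel h0] at this
      exact this.symm
    · exact h.near hj
  exists_parent r _ _ := by
    rcases h.exists_parent h0 hj r with h' | h'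
    · exact ⟨false, by simp, h'⟩
    · exact ⟨true, by simp, h'⟩
  root_unique r _ h' := absurd h' (h.pathDist_ne_zero h0 hj r)

theorem near_linkDist {u v : V} (hω : ∀ u v, G.Adj u v → 1 ≤ ω s(u, v)) (h : G.Adj u v) :
    Near (rootDist G ω S u) (linkDist G ω S u v) := by
  have h1 := (weightedNear_rootDist (ω := ω) (S := S) h).near (hω u v h)
  rwa [(weightedNear_rootDist h).pathDist_zero] at h1

theorem linkDist_add_one_eq_iff {u v r : V} (hω : ∀ u v, G.Adj u v → 1 ≤ ω s(u, v))
    (h : G.Adj u v) (hr : rootDist G ω S u r ≠ ⊤) :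
    linkDist G ω S u v r + 1 = rootDist G ω S u r ↔
      rootDist G ω S v r + (ω s(u, v) : ℕ) = rootDist G ω S u r :=
  (weightedNear_rootDist h).pathDist_one_add_one_eq_iff (hω u v h) hr

theorem linkDist_swap (hω : ∀ u v, G.Adj u v → 1 ≤ ω s(u, v)) {u v : V} (h : G.Adj u v) :
    linkDist G ω S v u =
      pathDist (rootDist G ω S u) (rootDist G ω S v) (ω s(u, v)) (ω s(u, v) - 1) := by
  rw [linkDist, Sym2.eq_swap, pathDist_swap (hω u v h)]

variable [LinearOrder V] [Fintype V] [DecidableRel G.Adj]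

/-- The neighbors of a node in the order in which they are processed. -/
def sortedNbrs (G : SimpleGraph V) [DecidableRel G.Adj] (u : V) : List V :=
  (G.neighborFinset u).sort (· ≤ ·)

theorem mem_sortedNbrs {u v : V} : v ∈ sortedNbrs G u ↔ G.Adj u v := by
  simp [sortedNbrs]

theorem localDist_core (hω : ∀ u v, G.Adj u v → 1 ≤ ω s(u, v)) (u : V) :
    LocalDist (sortedNbrs G u) (rootDist G ω S u) (linkDist G ω S u) where
  nodup := Finset.sort_nodup _ _
  near v hv := near_linkDist hω (mem_sortedNbrs.mp hv)
  exists_parent r hr h0 := by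
    have hS := mem_of_rootDist_ne_top hr
    have h1 : wdist G ω r u ≠ ⊤ := by rwa [rootDist_of_mem hS] at hr
    rcases eq_or_exists_adj_wdist_add h1 with rfl | ⟨v, hv, h2⟩
    · rw [rootDist_of_mem hS, wdist_self] at h0
      exact absurd rfl h0
    · refine ⟨v, mem_sortedNbrs.mpr hv.symm, (linkDist_add_one_eq_iff hω hv.symm hr).mpr ?_⟩
      rw [rootDist_of_mem hS, rootDist_of_mem hS, Sym2.eq_swap]
      exact h2
  root_unique r s hr hs := by
    have key : ∀ r, rootDist G ω S u r = 0 → r = u := fun r hr => by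
      have hS := mem_of_rootDist_ne_top (hr ▸ ENat.zero_ne_top)
      rw [rootDist_of_mem hS] at hr
      exact eq_of_wdist_eq_zero hω hr
    rw [key r hr, key s hs]

/-- The states of all nodes at the beginning of round `t`. -/
structure NetworkInv (G : SimpleGraph V) [DecidableRel G.Adj] (ω : Sym2 V → ℕ) (S : Finset V)
    (k t : ℕ) (st : V → DLGcompState V) : Prop where
  core : ∀ u, NodeInv (sortedNbrs G u) (rootDist G ω S u) (linkDist G ω S u) k t (st u).core
  relay : ∀ u v, G.Adj u v → ∀ j, 0 < j → j < ω s(u, v) →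
    NodeInv [false, true]
      (pathDist (rootDist G ω S (min u v)) (rootDist G ω S (max u v)) (ω s(u, v)) j)
      (relayPeers (rootDist G ω S (min u v)) (rootDist G ω S (max u v)) (ω s(u, v)) j) k t
      ((st u).relay v j)

theorem nodeInv_idle {P : Type*} {links : List P} {d : V → ℕ∞} {dp : P → V → ℕ∞} {k : ℕ}
    (h : ∀ r, d r ≠ 0) : NodeInv links d dp k 0 DLGState.idle := by
  constructor <;> simp [DLGState.idle, h]

theorem nodeInv_root {P : Type*} {links : List P} {d : V → ℕ∞} {dp : P → V → ℕ∞} {k : ℕ} {u : V}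
    (hw : LocalDist links d dp) (h : ∀ r, d r = 0 ↔ r = u) :
    NodeInv links d dp k 0 (DLGState.root u) := by
  constructor <;> simp only [DLGState.root, Finset.mem_singleton, h]
  · simp
  · simp
  · intro r
    simp only [Finset.notMem_empty, false_iff, not_and, not_lt]
    rintro rfl
    rw [hw.slot_root ((h r).mpr rfl)]
  · intro r
    split_ifs with hr
    · exact ((h r).mpr hr).symm
    · rfl
  · simp
  · simp

theorem relayInbox_delivers {d e : V → ℕ∞} {w k t : ℕ} (h : WeightedNear d e w)
    {rel : ℕ → DLGState V Bool} (hrel : ∀ j, 0 < j → j < w →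
      NodeInv [false, true] (pathDist d e w j) (relayPeers d e w j) k t (rel j))
    {lo hi : Option (DLGMessage V)} (hlo : Delivers (pathDist d e w 1) d t lo)
    (hhi : Delivers (pathDist d e w (w - 1)) e t hi) {j : ℕ} (h0 : 0 < j) (hj : j < w)
    (i : Bool) : Delivers (pathDist d e w j) (relayPeers d e w j i) t
      (DLGcompState.relayInbox rel w lo hi j i) := by
  cases i
  · simp only [relayPeers, DLGcompState.relayInbox]
    split_ifs with h1
    · subst h1
      rwa [Nat.sub_self, h.pathDist_zero]
    · have := (hrel (j - 1) (by omega) (by omega)).delivers (localDist_relay h (by omega) (by omega))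
        (i := true) (by simp)
      simpa only [relayPeers, Nat.sub_add_cancel h0] using this
  · simp only [relayPeers, DLGcompState.relayInbox]
    split_ifs with h1
    · subst h1
      rwa [h.pathDist_self]
    · have := (hrel (j + 1) (by omega) (by omega)).delivers (localDist_relay h (by omega) (by omega))
        (i := false) (by simp)
      simpa only [relayPeers, Nat.add_sub_cancel] using this

/-- Nodes and relays are all instances of `NodeInv.round`; it remains to match each inbox with the
peer that fills it. Relay positions count from the lower end, hence the case distinctions by order.
-/
theorem NetworkInv.step (hω : ∀ u v, G.Adj u v → 1 ≤ ω s(u, v)) {k t : ℕ}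
    {st : V → DLGcompState V} (h : NetworkInv G ω S k t st)
    {inbox : V → V → List (DLGMessage V)}
    (hin : ∀ u v, G.Adj u v → (inbox u v).head? = (st v).core.outgoing u) :
    NetworkInv G ω S k (t + 1) (fun u =>
      (DLGcomp V).recv (localView G ω S k u) t (st u) (inbox u)) := by
  have hcore : ∀ u v, G.Adj u v →
      Delivers (linkDist G ω S u v) (rootDist G ω S u) t ((st u).core.outgoing v) :=
    fun u v huv => (h.core u).delivers (localDist_core hω u) (mem_sortedNbrs.mpr huv)
  constructor
  · intro u
    refine (h.core u).round (localDist_core hω u) fun v hv => ?_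
    have huv : G.Adj u v := mem_sortedNbrs.mp hv
    have hnear := weightedNear_rootDist (ω := ω) (S := S) huv
    simp only [hin u v huv, localView, huv, if_true, DLGcompState.coreInbox]
    split_ifs with h1 h2
    · have hw : ω s(u, v) = 1 := le_antisymm h1 (hω u v huv)
      have h3 := hcore v u huv.symm
      rw [linkDist_swap hω huv, hw, Nat.sub_self, ← hw, hnear.pathDist_zero] at h3
      have h4 := hnear.pathDist_self
      rw [hw] at h4
      rwa [linkDist, hw, h4]
    · have h3 := (h.relay u v huv 1 (by omega) (by omega)).delivers
        (localDist_relay (by rwa [min_eq_left h2.le, max_eq_right h2.le]) (by omega) (by omega))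
        (i := false) (by simp)
      rw [min_eq_left h2.le, max_eq_right h2.le] at h3
      rw [linkDist]
      simpa only [relayPeers, Nat.sub_self, hnear.pathDist_zero] using h3
    · have h2' : v ≤ u := not_lt.mp h2
      have h3 := (h.relay u v huv (ω s(u, v) - 1) (by omega) (by omega)).delivers
        (localDist_relay (by rw [min_eq_right h2', max_eq_left h2']; exact hnear.symm) (by omega)
          (by omega)) (i := true) (by simp)
      rw [min_eq_right h2', max_eq_left h2'] at h3
      simp only [relayPeers, Nat.sub_add_cancel (hω u v huv), hnear.symm.pathDist_self] at h3
      rwa [linkDist, pathDist_swap (hω u v huv)]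
  · intro u v huv j h0 hj
    have hnear : WeightedNear (rootDist G ω S (min u v)) (rootDist G ω S (max u v)) (ω s(u, v)) := by
      rcases le_total u v with h1 | h1
      · rw [min_eq_left h1, max_eq_right h1]
        exact weightedNear_rootDist huv
      · rw [min_eq_right h1, max_eq_left h1]
        exact (weightedNear_rootDist huv).symm
    refine (h.relay u v huv j h0 hj).round (localDist_relay hnear h0 hj) fun i _ => ?_
    simp only [hin u v huv, localView, huv, if_true]
    refine relayInbox_delivers hnear (h.relay u v huv) ?_ ?_ h0 hj i
    · split_ifs with h1
      · rw [min_eq_left h1.le, max_eq_right h1.le]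
        exact hcore u v huv
      · rw [min_eq_right (not_lt.mp h1), max_eq_left (not_lt.mp h1), Sym2.eq_swap]
        exact hcore v u huv.symm
    · split_ifs with h1
      · rw [min_eq_left h1.le, max_eq_right h1.le, ← linkDist_swap hω huv]
        exact hcore v u huv.symm
      · rw [min_eq_right (not_lt.mp h1), max_eq_left (not_lt.mp h1), Sym2.eq_swap,
          ← linkDist_swap hω huv.symm]
        exact hcore u v huv

theorem networkInv_stateAt (hω : ∀ u v, G.Adj u v → 1 ≤ ω s(u, v)) (k t : ℕ) :
    NetworkInv G ω S k t ((DLGcomp V).stateAt G (localView G ω S k) t) := by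
  induction t with
  | zero =>
    constructor
    · intro u
      have h0 : ∀ r, rootDist G ω S u r = 0 → r = u ∧ r ∈ S := fun r hr => by
        have hS := mem_of_rootDist_ne_top (hr ▸ ENat.zero_ne_top)
        rw [rootDist_of_mem hS] at hr
        exact ⟨eq_of_wdist_eq_zero hω hr, hS⟩
      simp only [SyncAlgorithm.stateAt, DLGcomp, localView, decide_eq_true_eq]
      split_ifs with hu
      · refine nodeInv_root (localDist_core hω u) fun r => ⟨fun hr => (h0 r hr).1, ?_⟩
        rintro rfl
        rw [rootDist_of_mem hu, wdist_self]
      · refine nodeInv_idle fun r hr => ?_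
        obtain ⟨rfl, h2⟩ := h0 r hr
        exact hu h2
    · intro u v huv j h0 hj
      refine nodeInv_idle ?_
      have h2 := weightedNear_rootDist (ω := ω) (S := S) huv
      rcases le_total u v with h1 | h1
      · rw [min_eq_left h1, max_eq_right h1]
        exact h2.pathDist_ne_zero h0 hj
      · rw [min_eq_right h1, max_eq_left h1]
        exact h2.symm.pathDist_ne_zero h0 hj
  | succ t ih =>
    refine ih.step hω fun u v huv => ?_
    rw [if_pos huv.symm]
    exact Option.head?_toList

/-- The round in which DLGcomp delivers `r` over the edge from a parent `h` to `u`. -/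
noncomputable def arrivalTime (G : SimpleGraph V) (ω : Sym2 V → ℕ) (S : Finset V) (h u : V) :
    V → ℕ :=
  crossTime (rootDist G ω S u) (linkDist G ω S u h)

/-- Only roots in `S` occupy slots, so they delay `r` by at most `|S|`. -/
theorem crossTime_le {S : Finset V} {d e : V → ℕ∞} {k : ℕ} (hS : ∀ r, d r ≠ ⊤ → r ∈ S)
    (hn : Near d e) {r : V}
    (hr : d r ≤ k) : crossTime d e r ≤ S.card + k := by
  have h1 := slot_le (d := fun r => min (d r) (e r)) (S := S)
    (fun s hs => hS s (hn.ne_top_of_min hs)) r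
  have h2 : (min (d r) (e r)).toNat ≤ k :=
    ENat.toNat_le_of_le_natCast ((min_le_left _ _).trans hr)
  change slot (fun r => min (d r) (e r)) r ≤ _
  omega

theorem arc_iff {k : ℕ} (hω : ∀ u v, G.Adj u v → 1 ≤ ω s(u, v)) {r u v : V} (hr : r ∈ S) :
    (directedLeveledGraph G ω k r).arc u v ↔
      ParentLink (sortedNbrs G v) (rootDist G ω S v) (linkDist G ω S v) r u ∧
        rootDist G ω S v r ≤ k := by
  simp only [directedLeveledGraph, ParentLink, mem_sortedNbrs]
  constructor
  · rintro ⟨hadj, i, h1, h2, h3⟩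
    have hne : rootDist G ω S v r ≠ ⊤ := by
      rw [rootDist_of_mem hr, h3]
      exact ENat.natCast_ne_top _
    refine ⟨⟨hadj.symm, (linkDist_add_one_eq_iff hω hadj.symm hne).mpr ?_, hne⟩, ?_⟩
    · rw [rootDist_of_mem hr, rootDist_of_mem hr, h1, h3, Sym2.eq_swap]
      push_cast
      rfl
    · rw [rootDist_of_mem hr, h3]
      exact_mod_cast h2
  · rintro ⟨⟨hadj, h1, hne⟩, h2⟩
    rw [linkDist_add_one_eq_iff hω hadj hne, rootDist_of_mem hr, rootDist_of_mem hr,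
      Sym2.eq_swap] at h1
    rw [rootDist_of_mem hr] at hne h2
    have hu : wdist G ω r u ≠ ⊤ := by
      intro hu
      rw [hu, top_add] at h1
      exact hne h1.symm
    obtain ⟨i, hi⟩ := ENat.ne_top_iff_exists.mp hu
    rw [← hi] at h1
    refine ⟨hadj.symm, i, hi.symm, ?_, ?_⟩
    · rw [← h1] at h2
      exact_mod_cast h2
    · rw [← h1]
      push_cast
      rfl

theorem arrivalTime_le {k : ℕ} (hω : ∀ u v, G.Adj u v → 1 ≤ ω s(u, v)) {r u v : V} (hr : r ∈ S)
    (h : (directedLeveledGraph G ω k r).arc u v) : arrivalTime G ω S u v r ≤ S.card + k := by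
  obtain ⟨h1, h2⟩ := (arc_iff hω hr).mp h
  exact crossTime_le (fun _ => mem_of_rootDist_ne_top)
    ((localDist_core hω v).near u h1.1) h2

theorem arrivalTime_injOn {k : ℕ} (hω : ∀ u v, G.Adj u v → 1 ≤ ω s(u, v)) {r s u v : V}
    (hr : r ∈ S) (hs : s ∈ S) (h1 : (directedLeveledGraph G ω k r).arc u v)
    (h2 : (directedLeveledGraph G ω k s).arc u v)
    (h : arrivalTime G ω S u v r = arrivalTime G ω S u v s) : r = s :=
  crossTime_injOn ((arc_iff hω hr).mp h1).1.2.2 ((arc_iff hω hs).mp h2).1.2.2 h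

/-- At `u` the root arrives before its slot and leaves no earlier than its slot; on the path to `c`,
the slots of the relays only grow. -/
theorem arrivalTime_lt {k : ℕ} (hω : ∀ u v, G.Adj u v → 1 ≤ ω s(u, v)) {r h u c : V}
    (hr : r ∈ S) (h1 : (directedLeveledGraph G ω k r).arc h u)
    (h2 : (directedLeveledGraph G ω k r).arc u c) :
    arrivalTime G ω S h u r < arrivalTime G ω S u c r := by
  obtain ⟨h1, -⟩ := (arc_iff hω hr).mp h1
  obtain ⟨⟨hc, h3, h4⟩, -⟩ := (arc_iff hω hr).mp h2
  refine (h1.crossTime_lt_slot (localDist_core hω u)).trans_le ?_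
  have hadj := (mem_sortedNbrs.mp hc).symm
  have hnear := weightedNear_rootDist (ω := ω) (S := S) hadj
  have hw := hω u c hadj
  rw [linkDist_add_one_eq_iff hω hadj.symm h4, Sym2.eq_swap] at h3
  have hstep := fun (j : ℕ) (hj : j < ω s(u, c)) => hnear.pathDist_add_one hj h1.2.2 h3
  have hle : ∀ j < ω s(u, c), slot (rootDist G ω S u) r ≤
      slot (pathDist (rootDist G ω S u) (rootDist G ω S c) (ω s(u, c)) j) r := by
    intro j
    induction j with
    | zero =>
      intro _
      rw [hnear.pathDist_zero]
    | succ j ih =>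
      intro hj
      obtain ⟨h5, -⟩ := hstep j (by omega)
      have hn := hnear.near (j := j) (by omega)
      refine (ih (by omega)).trans ((hn.slot_le_crossTime (by rw [← h5]; exact le_self_add)).trans ?_)
      rw [crossTime_comm]
      exact (hn.symm.crossTime_lt_slot h5 (hstep (j + 1) hj).2).le
  refine (hle (ω s(u, c) - 1) (by omega)).trans ?_
  obtain ⟨h5, -⟩ := hstep (ω s(u, c) - 1) (by omega)
  have hn := hnear.near (j := ω s(u, c) - 1) (by omega)
  rw [Nat.sub_add_cancel hw, hnear.pathDist_self] at h5 hn
  rw [arrivalTime, linkDist_swap hω hadj, crossTime_comm]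
  exact hn.slot_le_crossTime (by rw [← h5]; exact le_self_add)

/-- The variables left by DLGcomp. -/
theorem networkInv_final (hω : ∀ u v, G.Adj u v → 1 ≤ ω s(u, v)) (k : ℕ) :
    NetworkInv G ω S k (S.card + k + 1) ((DLGcomp V).final G (localView G ω S k)) :=
  networkInv_stateAt hω k (S.card + k + 1)

theorem mem_parents_final_iff (hω : ∀ u v, G.Adj u v → 1 ≤ ω s(u, v)) {k : ℕ} {r u v : V} {τ : ℕ} :
    (u, τ) ∈ ((DLGcomp V).final G (localView G ω S k) v).core.parents r ↔
      r ∈ S ∧ (directedLeveledGraph G ω k r).arc u v ∧ τ = arrivalTime G ω S u v r := by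
  rw [((networkInv_final hω k).core v).mem_parents]
  constructor
  · rintro ⟨h1, h2, h3, _⟩
    have hr := mem_of_rootDist_ne_top h1.2.2
    exact ⟨hr, (arc_iff hω hr).mpr ⟨h1, h2⟩, h3⟩
  · rintro ⟨hr, h1, h2⟩
    obtain ⟨h3, h4⟩ := (arc_iff hω hr).mp h1
    have := arrivalTime_le hω hr h1
    exact ⟨h3, h4, h2, by omega⟩

theorem mem_L_final (hω : ∀ u v, G.Adj u v → 1 ≤ ω s(u, v)) {k : ℕ} {r u : V}
    (h : rootDist G ω S u r ≤ k) :
    r ∈ ((DLGcomp V).final G (localView G ω S k) u).core.L := by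
  rw [((networkInv_final hω k).core u).mem_L]
  by_cases h0 : rootDist G ω S u r = 0
  · exact Or.inl h0
  · have hne := ne_top_of_le_ne_top (ENat.natCast_ne_top k) h
    obtain ⟨v, hv, hp⟩ := (localDist_core hω u).exists_parent r hne h0
    exact Or.inr ⟨v, ⟨hv, hp, hne⟩, Nat.lt_succ_of_le (crossTime_le
      (fun _ => mem_of_rootDist_ne_top) ((localDist_core hω u).near v hv) h)⟩

theorem storedLeveledGraph_final (hω : ∀ u v, G.Adj u v → 1 ≤ ω s(u, v)) {k : ℕ} {r : V}
    (hr : r ∈ S) : storedLeveledGraph k ((DLGcomp V).final G (localView G ω S k)) r =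
      directedLeveledGraph G ω k r := by
  ext i v
  · refine and_congr_right fun hi => ?_
    rw [((networkInv_final hω k).core v).dist_eq]
    by_cases h : rootDist G ω S v r ≤ k
    · rw [if_pos (mem_L_final hω h), rootDist_of_mem hr]
    -- Beyond depth `k` the stored distance may be the true one or `⊤`; neither equals a level `i ≤
    -- k`.
    · rw [← rootDist_of_mem (G := G) (ω := ω) hr]
      split_ifs
      · rfl
      · refine ⟨fun h' => absurd h'.symm (ENat.natCast_ne_top i), fun h' => absurd ?_ h⟩
        rw [h']
        exact_mod_cast hi
  · simp [storedLeveledGraph, mem_parents_final_iff hω, hr]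

end Network

/-! ### Correctness of DLGagr -/

section ListLemmas

variable {α β : Type*}

theorem filter_eq_singleton {l : List α} (hl : l.Nodup) {p : α → Bool} {a : α} (ha : a ∈ l)
    (hp : ∀ b ∈ l, p b = true ↔ b = a) : l.filter p = [a] := by
  refine List.perm_singleton.mp ((List.perm_ext_iff_of_nodup (hl.filter p) (by simp)).mpr ?_)
  intro b
  rw [List.mem_filter, List.mem_singleton]
  exact ⟨fun h => (hp b h.1).mp h.2, fun h => by rw [h]; exact ⟨ha, (hp a ha).mpr rfl⟩⟩

theorem flatMap_eq_of_unique {l : List α} (hl : l.Nodup) {f : α → List β} {a : α} (ha : a ∈ l)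
    (hf : ∀ b ∈ l, b ≠ a → f b = []) : l.flatMap f = f a := by
  induction l with
  | nil => simp at ha
  | cons c l ih =>
    rw [List.nodup_cons] at hl
    rw [List.flatMap_cons]
    rcases List.mem_cons.mp ha with rfl | ha'
    · have : l.flatMap f = [] := List.flatMap_eq_nil_iff.mpr fun b hb =>
        hf b (by simp [hb]) fun h => hl.1 (h ▸ hb)
      rw [this, List.append_nil]
    · rw [hf c (by simp) fun h => hl.1 (h ▸ ha'), List.nil_append]
      exact ih hl.2 ha' fun b hb => hf b (by simp [hb])

end ListLemmas

section Aggregation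

variable {V β M : Type*} [LinearOrder V] [Fintype V] {G : SimpleGraph V} [DecidableRel G.Adj]
  {ω : Sym2 V → ℕ} {S : Finset V} {k : ℕ} {agg : Aggregator V β M}

/-- The inputs of DLGagr that are left by DLGcomp. -/
def aggregationInput (G : SimpleGraph V) [DecidableRel G.Adj] (ω : Sym2 V → ℕ) (S : Finset V)
    (k : ℕ) (u : V) : DLGagrInput V :=
  ⟨localView G ω S k u, (DLGcomp V).final G (localView G ω S k) u⟩

/-- In round `t` of DLGagr the node `v` sends its message for the root `r` to its parent `u`. -/
def SendsAt (G : SimpleGraph V) (ω : Sym2 V → ℕ) (S : Finset V) (k t : ℕ) (u v r : V) : Prop :=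
  r ∈ S ∧ (directedLeveledGraph G ω k r).arc u v ∧ t + arrivalTime G ω S u v r = S.card + k

theorem SendsAt.unique (hω : ∀ u v, G.Adj u v → 1 ≤ ω s(u, v)) {t : ℕ} {u v r s : V}
    (hr : SendsAt G ω S k t u v r) (hs : SendsAt G ω S k t u v s) : r = s :=
  arrivalTime_injOn hω hr.1 hs.1 hr.2.1 hs.2.1 (by have := hr.2.2; have := hs.2.2; omega)

theorem send_entry_of_sendsAt (hω : ∀ u v, G.Adj u v → 1 ≤ ω s(u, v)) {t : ℕ} {u v r : V}
    (h : SendsAt G ω S k t u v r) (m : V × M) :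
    ((((DLGcomp V).final G (localView G ω S k) v).core.parents r).filter fun p =>
      decide (p.1 = u ∧ t + p.2 = S.card + k)).map (fun _ => m) = [m] := by
  rw [filter_eq_singleton (((networkInv_final hω k).core v).nodup_parents r)
    ((mem_parents_final_iff hω).mpr ⟨h.1, h.2.1, rfl⟩)]
  · rfl
  · rintro ⟨x, τ⟩ hx
    have h1 := (mem_parents_final_iff hω).mp hx
    have h2 := h.2.2
    simp only [decide_eq_true_eq, Prod.mk.injEq]
    refine and_congr_right ?_
    rintro rfl
    omega

theorem send_entry_of_not_sendsAt (hω : ∀ u v, G.Adj u v → 1 ≤ ω s(u, v)) {t : ℕ} {u v r : V}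
    (h : ¬ SendsAt G ω S k t u v r) (m : V × M) :
    ((((DLGcomp V).final G (localView G ω S k) v).core.parents r).filter fun p =>
      decide (p.1 = u ∧ t + p.2 = S.card + k)).map (fun _ => m) = [] := by
  rw [List.map_eq_nil_iff, List.filter_eq_nil_iff]
  rintro ⟨x, τ⟩ hx
  obtain ⟨h1, h2, h3⟩ := (mem_parents_final_iff hω).mp hx
  simp only [decide_eq_true_eq]
  rintro ⟨rfl, h4⟩
  exact h ⟨h1, h2, by rw [← h3]; exact h4⟩

theorem send_eq_singleton (hω : ∀ u v, G.Adj u v → 1 ≤ ω s(u, v)) {t : ℕ} {u v r : V}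
    (h : SendsAt G ω S k t u v r) (val : V → β) :
    (DLGagr agg).send (aggregationInput G ω S k v) t val u = [(r, agg.out v r (val r))] := by
  have hd := ((arc_iff hω h.1).mp h.2.1).2
  refine (flatMap_eq_of_unique (Finset.sort_nodup _ _) (a := r) ?_ fun s _ hs => ?_).trans
    (send_entry_of_sendsAt hω h _)
  · rw [Finset.mem_sort]
    exact mem_L_final hω hd
  · exact send_entry_of_not_sendsAt hω (fun h' => hs (h'.unique hω h)) _

theorem send_eq_nil (hω : ∀ u v, G.Adj u v → 1 ≤ ω s(u, v)) {t : ℕ} {u v : V}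
    (h : ∀ r, ¬ SendsAt G ω S k t u v r) (val : V → β) :
    (DLGagr agg).send (aggregationInput G ω S k v) t val u = [] :=
  List.flatMap_eq_nil_iff.mpr fun r _ => send_entry_of_not_sendsAt hω (h r) _

open Classical in
/-- The children from which a node receives a message for the root `r` in round `t`. -/
noncomputable def sendingChildren (G : SimpleGraph V) [DecidableRel G.Adj] (ω : Sym2 V → ℕ)
    (S : Finset V) (k : ℕ) (u r : V) (t : ℕ) : List V :=
  (sortedNbrs G u).filter fun v => decide (SendsAt G ω S k t u v r)

theorem mem_sendingChildren {t : ℕ} {u v r : V} :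
    v ∈ sendingChildren G ω S k u r t ↔ SendsAt G ω S k t u v r := by
  simp only [sendingChildren, List.mem_filter, mem_sortedNbrs, decide_eq_true_eq,
    and_iff_right_iff_imp]
  exact fun h => h.2.1.1

/-- An edge carries at most one message per round, and a message for another root leaves the value
for `r` untouched. -/
theorem stateAt_succ (hω : ∀ u v, G.Adj u v → 1 ≤ ω s(u, v)) (t : ℕ) (u r : V) :
    (DLGagr agg).stateAt G (aggregationInput G ω S k) (t + 1) u r =
      (sendingChildren G ω S k u r t).foldl (fun b c => agg.step u r c (agg.out c r
        ((DLGagr agg).stateAt G (aggregationInput G ω S k) t c r)) b)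
        ((DLGagr agg).stateAt G (aggregationInput G ω S k) t u r) := by
  set st := (DLGagr agg).stateAt G (aggregationInput G ω S k) t with hst
  have key : ∀ (l : List V), (∀ v ∈ l, G.Adj v u) → ∀ val : V → β,
      l.foldl (fun val' v => (if G.Adj v u then
        (DLGagr agg).send (aggregationInput G ω S k v) t (st v) u else []).foldl
          (fun val'' m => Function.update val'' m.1 (agg.step u m.1 v m.2 (val'' m.1))) val') val r =
      (l.filter fun v => @decide (SendsAt G ω S k t u v r) (Classical.propDecidable _)).foldl
        (fun b c => agg.step u r c (agg.out c r (st c r)) b) (val r) := by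
    intro l
    induction l with
    | nil => exact fun _ _ => rfl
    | cons v l ih =>
      intro hl val
      rw [List.foldl_cons, ih (fun x hx => hl x (by simp [hx])), if_pos (hl v (by simp))]
      by_cases h : SendsAt G ω S k t u v r
      · rw [send_eq_singleton hω h, List.filter_cons_of_pos (by simpa using h)]
        simp
      · rw [List.filter_cons_of_neg (by simpa using h)]
        congr 1
        by_cases hex : ∃ s, SendsAt G ω S k t u v s
        · obtain ⟨s, hs⟩ := hex
          have hrs : r ≠ s := fun hrs => h (hrs ▸ hs)
          rw [send_eq_singleton hω hs]
          simp [hrs]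
        · rw [send_eq_nil hω (fun s hs => hex ⟨s, hs⟩)]
          rfl
  exact key (sortedNbrs G u) (fun v hv => (mem_sortedNbrs.mp hv).symm) (st u)

theorem stateAt_eq_of_no_message (hω : ∀ u v, G.Adj u v → 1 ≤ ω s(u, v)) {t : ℕ} {u r : V}
    (h : ∀ t' ≥ t, ∀ c, ¬ SendsAt G ω S k t' u c r) {t' : ℕ} (ht : t ≤ t') :
    (DLGagr agg).stateAt G (aggregationInput G ω S k) t' u r =
      (DLGagr agg).stateAt G (aggregationInput G ω S k) t u r := by
  induction t', ht using Nat.le_induction with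
  | base => rfl
  | succ t' ht ih =>
    have hnil : sendingChildren G ω S k u r t' = [] :=
      List.eq_nil_iff_forall_not_mem.mpr fun c hc => h t' ht c (mem_sendingChildren.mp hc)
    rw [stateAt_succ hω, hnil, ← ih]
    rfl

/-- When a node sends its message for a root, its value for this root is final. -/
theorem SendsAt.stateAt_eq_final (hω : ∀ u v, G.Adj u v → 1 ≤ ω s(u, v)) {t : ℕ} {u v r : V}
    (h : SendsAt G ω S k t u v r) :
    (DLGagr agg).stateAt G (aggregationInput G ω S k) t v r =
      (DLGagr agg).final G (aggregationInput G ω S k) v r := by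
  obtain ⟨hr, h1, h2⟩ := h
  refine (stateAt_eq_of_no_message hω (fun t' ht' c hc => ?_)
    (show t ≤ S.card + k + 1 by omega)).symm
  -- A child of `v` has a later arrival time than `v`, so in the reversed order it sends before
  -- round `t`.
  have h3 := arrivalTime_lt hω hr h1 hc.2.1
  have h4 := hc.2.2
  omega

theorem isBottomUpAggregate_final (hω : ∀ u v, G.Adj u v → 1 ≤ ω s(u, v)) {r : V} (hr : r ∈ S) :
    IsBottomUpAggregate agg (directedLeveledGraph G ω k r) r
      (fun u => (DLGagr agg).final G (aggregationInput G ω S k) u r) := by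
  intro u
  -- The children are listed by the round of their message; each has one arrival time, hence one
  -- round.
  refine ⟨(List.range (S.card + k + 1)).flatMap (sendingChildren G ω S k u r), ?_, fun c => ?_, ?_⟩
  · rw [List.nodup_flatMap]
    refine ⟨fun t _ => (Finset.sort_nodup _ _).filter _, List.nodup_range.imp fun {a b} hab => ?_⟩
    intro c ha hb
    have h1 := (mem_sendingChildren.mp ha).2.2
    have h2 := (mem_sendingChildren.mp hb).2.2
    omega
  · simp only [List.mem_flatMap, List.mem_range, mem_sendingChildren]
    constructor
    · rintro ⟨t, _, h⟩
      exact h.2.1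
    · intro h
      have := arrivalTime_le hω hr h
      exact ⟨S.card + k - arrivalTime G ω S u c r, by omega, hr, h, by omega⟩
  · have key : ∀ t, (DLGagr agg).stateAt G (aggregationInput G ω S k) t u r =
        ((List.range t).flatMap (sendingChildren G ω S k u r)).foldl
          (fun b c => agg.step u r c (agg.out c r
            ((DLGagr agg).final G (aggregationInput G ω S k) c r)) b) (agg.start u r) := by
      intro t
      induction t with
      | zero => rfl
      | succ t ih =>
        rw [stateAt_succ hω, List.range_succ, List.flatMap_append, List.foldl_append, ← ih,
          List.flatMap_singleton]
        refine List.foldl_ext _ _ _ fun b c hc => ?_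
        rw [(mem_sendingChildren.mp hc).stateAt_eq_final hω]
    exact key (S.card + k + 1)

end Aggregation

/-! ### Message lengths. -/

section Bandwidth

/-- For `n ≥ 2` the logarithm is at least one and absorbs the additive constants. -/
theorem size_le_of_le_pow {n c i : ℕ} (hn : 2 ≤ n) (h : i ≤ n ^ c) :
    Nat.size i ≤ (2 * c + 1) * Nat.log 2 n := by
  have h1 : 1 ≤ Nat.log 2 n := Nat.log_pos one_lt_two hn
  have h2 : i < 2 ^ ((Nat.log 2 n + 1) * c + 1) := by
    refine lt_of_le_of_lt (h.trans (Nat.pow_le_pow_left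
      (Nat.lt_pow_succ_log_self one_lt_two n).le c)) ?_
    rw [← pow_mul]
    exact Nat.pow_lt_pow_right one_lt_two (Nat.lt_succ_self _)
  refine (Nat.size_le.mpr h2).trans ?_
  nlinarith

theorem size_le_of_le_mul {n W i : ℕ} (hn : 2 ≤ n) (h : i ≤ n * W) :
    Nat.size i ≤ 3 * (Nat.log 2 n + Nat.log 2 W) := by
  have h1 : 1 ≤ Nat.log 2 n := Nat.log_pos one_lt_two hn
  have h2 : i < 2 ^ (Nat.log 2 n + 1 + (Nat.log 2 W + 1)) := by
    rw [pow_add]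
    exact lt_of_le_of_lt h (Nat.mul_lt_mul'' (Nat.lt_pow_succ_log_self one_lt_two n)
      (Nat.lt_pow_succ_log_self one_lt_two W))
  have := Nat.size_le.mpr h2
  omega

theorem two_le_card_of_adj {V : Type*} [Fintype V] {G : SimpleGraph V} {u v : V} (h : G.Adj u v) :
    2 ≤ Fintype.card V :=
  Fintype.one_lt_card_iff.mpr ⟨u, v, h.ne⟩

variable {V : Type*} [LinearOrder V] [Fintype V] {G : SimpleGraph V} [DecidableRel G.Adj]
  {ω : Sym2 V → ℕ} {S : Finset V} {k : ℕ} {ID : V ↪o ℕ} {c : ℕ}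

theorem DLGcomp_respectsBandwidth {W : ℕ} (hID : ∀ v, ID v ≤ Fintype.card V ^ c)
    (hω : ∀ u v, G.Adj u v → 1 ≤ ω s(u, v)) (hW : ∀ u v, G.Adj u v → ω s(u, v) ≤ W) :
    (DLGcomp V).RespectsBandwidth G (localView G ω S k)
      (fun m => Nat.size (ID m.1) + Nat.size m.2)
      ((2 * c + 4) * (Nat.log 2 (Fintype.card V) + Nat.log 2 W)) := by
  intro u v huv t _
  refine ⟨Option.length_toList_le, fun m hm => ?_⟩
  have hn := two_le_card_of_adj huv
  have hm' := Option.mem_toList.mp hm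
  rcases ((networkInv_stateAt (S := S) hω k t).core u).outgoing_eq (mem_sortedNbrs.mpr huv) with
    ⟨_, h⟩ | ⟨r, _, hr, h⟩
  · rw [h] at hm'
    cases hm'
  · rw [h] at hm'
    cases hm'
    have hS := mem_of_rootDist_ne_top hr
    rw [rootDist_of_mem hS] at hr ⊢
    have h1 := toNat_wdist_le hW hr
    have hW1 : 1 ≤ W := (hω u v huv).trans (hW u v huv)
    -- The message carries the distance plus one, and `(n - 1) * W + 1 ≤ n * W` because an edge
    -- forces `W ≥ 1`.
    have h2 : (wdist G ω r u).toNat + 1 ≤ Fintype.card V * W := by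
      obtain ⟨n, hn'⟩ := Nat.exists_eq_add_of_le hn
      rw [hn'] at h1 ⊢
      have : 2 + n - 1 = n + 1 := by omega
      rw [this] at h1
      nlinarith
    have h3 := size_le_of_le_mul hn h2
    have h4 := size_le_of_le_pow hn (hID r)
    refine (Nat.add_le_add h4 h3).trans ?_
    nlinarith [Nat.zero_le (c * Nat.log 2 W), Nat.zero_le (Nat.log 2 W)]

/-- A bound on messages computed from final values suffices, as a node sends for a root only once
its value is final. -/
theorem DLGagr_respectsBandwidth {β M : Type*} {agg : Aggregator V β M}
    (hID : ∀ v, ID v ≤ Fintype.card V ^ c) (hω : ∀ u v, G.Adj u v → 1 ≤ ω s(u, v))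
    {size : M → ℕ} {b : ℕ} (hb : ∀ u, ∀ r ∈ S,
      size (agg.out u r ((DLGagr agg).final G (aggregationInput G ω S k) u r)) ≤ b) :
    (DLGagr agg).RespectsBandwidth G (aggregationInput G ω S k)
      (fun m => Nat.size (ID m.1) + size m.2)
      ((2 * c + 4) * Nat.log 2 (Fintype.card V) + b) := by
  intro u v huv t _
  by_cases hex : ∃ r, SendsAt G ω S k t v u r
  · obtain ⟨r, hr⟩ := hex
    rw [send_eq_singleton hω hr]
    refine ⟨le_rfl, fun m hm => ?_⟩
    rw [List.mem_singleton.mp hm]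
    have h1 := size_le_of_le_pow (two_le_card_of_adj huv) (hID r)
    have h2 := hb u r hr.1
    rw [← hr.stateAt_eq_final hω] at h2
    refine Nat.add_le_add (h1.trans ?_) h2
    exact Nat.mul_le_mul_right _ (by omega)
  · rw [send_eq_nil hω (fun r hr => hex ⟨r, hr⟩)]
    simp

end Bandwidth

theorem theorem1 :
    ∃ C : ℕ, ∀ c : ℕ, ∃ B : ℕ,
      ∀ (V : Type*) [Fintype V] [LinearOrder V] (ID : V ↪o ℕ)
        (G : SimpleGraph V) [DecidableRel G.Adj] (ω : Sym2 V → ℕ) (W : ℕ)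
        (S : Finset V) (k : ℕ),
        (∀ v, ID v ≤ Fintype.card V ^ c) →
        (∀ u v, G.Adj u v → 1 ≤ ω s(u, v) ∧ ω s(u, v) ≤ W) →
        S.Nonempty →
        -- DLGcomp
        ((∀ u, (DLGcomp V).rounds (localView G ω S k u) ≤ C * (S.card + k)) ∧
          (DLGcomp V).RespectsBandwidth G (localView G ω S k)
            (fun m => Nat.size (ID m.1) + Nat.size m.2)
            (B * (Nat.log 2 (Fintype.card V) + Nat.log 2 W)) ∧
          ∀ r ∈ S, storedLeveledGraph k ((DLGcomp V).final G (localView G ω S k)) r =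
            directedLeveledGraph G ω k r) ∧
        -- DLGagr, run on the result of DLGcomp
        ∀ (β M : Type*) (agg : Aggregator V β M),
          let input : V → DLGagrInput V := fun u =>
            ⟨localView G ω S k u, (DLGcomp V).final G (localView G ω S k) u⟩
          let result : V → V → β := (DLGagr agg).final G input
          (∀ u, (DLGagr agg).rounds (input u) ≤ C * (S.card + k)) ∧
          (∀ (size : M → ℕ) (b : ℕ), (∀ u, ∀ r ∈ S, size (agg.out u r (result u r)) ≤ b) →
            (DLGagr agg).RespectsBandwidth G input (fun m => Nat.size (ID m.1) + size m.2)
              (B * Nat.log 2 (Fintype.card V) + b)) ∧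
          ∀ r ∈ S, IsBottomUpAggregate agg (directedLeveledGraph G ω k r) r
            (fun u => result u r) := by
  -- The factor `2` absorbs the extra round, as `S` is nonempty. In `2 * c + 4`, the name costs `2 *
  -- c + 1` and the distance `3`.
  refine ⟨2, fun c => ⟨2 * c + 4, ?_⟩⟩
  intro V _ _ ID G _ ω W S k hID hωW hS
  have hω : ∀ u v, G.Adj u v → 1 ≤ ω s(u, v) := fun u v h => (hωW u v h).1
  have hcard : S.card + k + 1 ≤ 2 * (S.card + k) := by
    have := hS.card_pos
    omega
  refine ⟨⟨fun _ => hcard, DLGcomp_respectsBandwidth hID hω fun u v h => (hωW u v h).2,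
    fun r hr => storedLeveledGraph_final hω hr⟩, ?_⟩
  intro β M agg
  exact ⟨fun _ => hcard, fun size b hb => DLGagr_respectsBandwidth hID hω hb,
    fun r hr => isBottomUpAggregate_final hω hr⟩
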